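/- **Conventions.** Functions are scalar-valued (scalar field $\mathbb K=\mathbb R$ or $\mathbb C$) and identified when equal a.e.; $\mathcal M^+(R,\mu)$ denotes the $[0,\infty]$-valued $\mu$-measurable functions on a $\sigma$-finite measure space $(R,\mu)$. Consider the following properties of $\rho:\mathcal M^+(R,\mu)\to[0,\infty]$, for some constant $C\in[1,\infty)$, all $f,g,f_k\in\mathcal M^+(R,\mu)$, $a\ge 0$ and measurable $E\subseteq R$: * (P1) $\rho(f)=0\Leftrightarrow f=0$ a.e.; $\rho(af)=a\rho(f)$; $\rho(f+g)\le C(\rho(f)+\rho(g))$; * (P2) $g\le f$ a.e. $\Rightarrow\rho(g)\le\rho(f)$; * (P3) $f_k\uparrow f$ a.e. $\Rightarrow\rho(f_k)\uparrow\rho(f)$; * (P4) $\mu(E)<\infty\Rightarrow\rho(\chi_E)<\infty$; * (P5) $\mu(E)<\infty\Rightarrow\int_E f\,d\mu\le c_E\,\rho(f)$ for all $f$, with some $c_E\in(0,\infty)$ independent of $f$. If (P1)–(P3) hold, the space $X=X(\rho)$ of all measurable $f$ with $\|f\|_X:=\rho(|f|)<\infty$ is called a *quasi-Banach function lattice* (q-BFL)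 over $R$. If (P1)–(P4) hold, it is a *quasi-Banach function space* (q-BFS), and if (P1) with $C=1$ and (P2)–(P5) hold, it is a *Banach function space* (BFS). Two such spaces *coincide* if they are equal as sets with equivalent quasi-norms. A q-BFS $X(\rho)$ is a *power q-BFS* if for some $b\in(0,1]$ the space $X(\sigma)$, $\sigma(f):=\rho(f^{1/b})^b$, coincides with a BFS. For measurable sets, $E_m\to\emptyset$ a.e. means that $\bigcap_k\bigcup_{m\ge k}E_m$ is a null set. For a q-BFL $X$, $X_a$ is the set of $f\in X$ such that $\|f\chi_{E_m}\|_X\to0$ whenever $E_m\to\emptyset$ a.e. A set $K\subseteq X_a$ has *uniformly absolutely continuous quasi-norm* in $X$ if $\sup_{f\in K}\|f\chi_{E_m}\|_X\to0$ as $m\to\infty$ whenever $E_m\to\emptyset$ a.e. Let $\mathbb R^n$ and $(0,1)$ carry Lebesgue measure. For a q-BFS $L=L(\mathbb R^n)$ over $\mathbb R^n$ and $f\in L$ put $\omega_L(f,t):=\sup_{|h|\le t}\|f(\cdot+h)-f\|_L$. For a q-BFL $Y$ over $(0,1)$ with $\|1\|_Y=\infty$, the *abstract Besov space* $B(L,Y)$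 is the set of all $f\in L$ with $$\|f\|_{B(L,Y)}:=\|f\|_L+\|\omega_L(f,\cdot)\|_Y<\infty,$$ endowed with this quasi-norm. **Statement.** Let $L=L(\mathbb R^n)$ be a power q-BFS; in the case that $L$ does not coincide with a BFS, assume that $L=L_a$. Let $Y$ be a q-BFL over $(0,1)$ with $\|1\|_Y=\infty$. Let $\Omega\subset\mathbb R^n$ be bounded and Lebesgue measurable with positive measure, and let $Z(\Omega)$ be a q-BFS over $\Omega$ with the restricted Lebesgue measure. Assume that $f|_\Omega\in (Z(\Omega))_a$ for every $f\in B(L,Y)$. Then the restriction operator $f\mapsto f|_\Omega$ is compact from $B(L,Y)$ into $Z(\Omega)$ if and only if the set $$K:=\{f|_\Omega:\ f\in B(L,Y),\ \|f\|_{B(L,Y)}\le1\}$$ has uniformly absolutely continuous quasi-norm in $Z(\Omega)$. -/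

import Mathlib

open MeasureTheory Filter Topology Set
open scoped ENNReal NNReal Pointwise

namespace QBFS

section Abstract

variable {α : Type*} [MeasurableSpace α]

/-- Properties (P1), (P2), (P3) of a functional `ρ` on the nonnegative (extended-valued)
`μ`-measurable functions, with constant `C` in the quasi-triangle inequality.
The value of `ρ` at non-measurable functions is irrelevant. -/
structure IsLatticeQuasiNormWith (μ : Measure α) (C : ℝ≥0) (ρ : (α → ℝ≥0∞) → ℝ≥0∞) : Prop where
  eq_zero_iff : ∀ f, AEMeasurable f μ → (ρ f = 0 ↔ f =ᵐ[μ] 0)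
  const_mul : ∀ (a : ℝ≥0) (f), AEMeasurable f μ → ρ (fun x => (a : ℝ≥0∞) * f x) = a * ρ f
  add_le : ∀ f g, AEMeasurable f μ → AEMeasurable g μ →
    ρ (fun x => f x + g x) ≤ C * (ρ f + ρ g)
  mono : ∀ f g, AEMeasurable f μ → AEMeasurable g μ → g ≤ᵐ[μ] f → ρ g ≤ ρ f
  tendsto_of_monotone : ∀ (f : ℕ → α → ℝ≥0∞) (g : α → ℝ≥0∞),
    (∀ k, AEMeasurable (f k) μ) → AEMeasurable g μ →
    (∀ᵐ x ∂μ, Monotone (fun k => f k x)) →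
    (∀ᵐ x ∂μ, Tendsto (fun k => f k x) atTop (𝓝 (g x))) →
    Tendsto (fun k => ρ (f k)) atTop (𝓝 (ρ g))

/-- `ρ` satisfies (P1), (P2), (P3), so that it defines a quasi-Banach function lattice. -/
def IsLatticeQuasiNorm (μ : Measure α) (ρ : (α → ℝ≥0∞) → ℝ≥0∞) : Prop :=
  ∃ C : ℝ≥0, 1 ≤ C ∧ IsLatticeQuasiNormWith μ C ρ

/-- `ρ` is a function quasi-norm: (P1), (P2), (P3) and (P4), so that it defines a quasi-Banach
function space. -/
structure IsFunctionQuasiNorm (μ : Measure α) (ρ : (α → ℝ≥0∞) → ℝ≥0∞) : Prop where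
  lattice : IsLatticeQuasiNorm μ ρ
  indicator_lt_top : ∀ E, MeasurableSet E → μ E < ∞ → ρ (E.indicator fun _ => 1) < ∞

/-- `ρ` is a function norm: (P1) with `C = 1`, (P2), (P3), (P4) and (P5), so that it defines a
Banach function space. -/
structure IsFunctionNorm (μ : Measure α) (ρ : (α → ℝ≥0∞) → ℝ≥0∞) : Prop where
  lattice : IsLatticeQuasiNormWith μ 1 ρ
  indicator_lt_top : ∀ E, MeasurableSet E → μ E < ∞ → ρ (E.indicator fun _ => 1) < ∞
  lintegral_le : ∀ E, MeasurableSet E → μ E < ∞ →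
    ∃ c : ℝ≥0, 0 < c ∧ ∀ f, AEMeasurable f μ → ∫⁻ x in E, f x ∂μ ≤ c * ρ f

/-- The space defined by `ρ` coincides with a Banach function space: for some function norm `τ`
the functionals `ρ` and `τ` are equivalent. Since both are `[0, ∞]`-valued, this contains the
equality of the two spaces as sets. -/
def CoincidesWithBFS (μ : Measure α) (ρ : (α → ℝ≥0∞) → ℝ≥0∞) : Prop :=
  ∃ τ : (α → ℝ≥0∞) → ℝ≥0∞, IsFunctionNorm μ τ ∧ ∃ c : ℝ≥0, 0 < c ∧
    ∀ f, AEMeasurable f μ → ρ f ≤ c * τ f ∧ τ f ≤ c * ρ f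

/-- The functional `σ(f) = ρ(f ^ (1/b)) ^ b`. -/
noncomputable def powerFunctional (b : ℝ) (ρ : (α → ℝ≥0∞) → ℝ≥0∞) (f : α → ℝ≥0∞) : ℝ≥0∞ :=
  (ρ fun x => f x ^ (1 / b)) ^ b

/-- The function quasi-norm `ρ` defines a power quasi-Banach function space. -/
def IsPowerQBFS (μ : Measure α) (ρ : (α → ℝ≥0∞) → ℝ≥0∞) : Prop :=
  ∃ b : ℝ, 0 < b ∧ b ≤ 1 ∧ CoincidesWithBFS μ (powerFunctional b ρ)

/-- The topology of a quasi-normed group: the balls `{f | N f < ε}` form a basis of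
neighbourhoods of `0`. -/
@[reducible]
def quasiNormBasis {E : Type*} [AddCommGroup E] (N : E → ℝ≥0∞) (h0 : N 0 = 0)
    (hneg : ∀ f, N (-f) ≤ N f) (hadd : ∃ C : ℝ≥0, ∀ f g, N (f + g) ≤ C * (N f + N g)) :
    AddGroupFilterBasis E :=
  addGroupFilterBasisOfComm {U | ∃ ε : ℝ≥0, 0 < ε ∧ U = {f | N f < ε}}
    ⟨_, 1, one_pos, rfl⟩
    (by
      rintro _ _ ⟨ε, hε, rfl⟩ ⟨δ, hδ, rfl⟩
      refine ⟨_, ⟨min ε δ, lt_min hε hδ, rfl⟩, fun f hf => ?_⟩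
      simp only [mem_ofPred_eq] at hf
      exact ⟨hf.trans_le (by exact_mod_cast min_le_left ε δ),
        hf.trans_le (by exact_mod_cast min_le_right ε δ)⟩)
    (by
      rintro _ ⟨ε, hε, rfl⟩
      simpa [h0] using hε)
    (by
      rintro _ ⟨ε, hε, rfl⟩
      obtain ⟨C, hC⟩ := hadd
      have hpos : 0 < ε / (2 * (C + 1)) := by positivity
      refine ⟨_, ⟨ε / (2 * (C + 1)), hpos, rfl⟩, ?_⟩
      rintro _ ⟨f, hf, g, hg, rfl⟩
      simp only [mem_ofPred_eq] at hf hg ⊢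
      have hsum : N f + N g < ((ε / (2 * (C + 1)) + ε / (2 * (C + 1)) : ℝ≥0) : ℝ≥0∞) := by
        rw [ENNReal.coe_add]; exact ENNReal.add_lt_add hf hg
      calc N (f + g) ≤ C * (N f + N g) := hC f g
        _ ≤ C * ((ε / (2 * (C + 1)) + ε / (2 * (C + 1)) : ℝ≥0) : ℝ≥0∞) := by gcongr
        _ < ε := by
          rw [← ENNReal.coe_mul, ENNReal.coe_lt_coe, ← NNReal.coe_lt_coe]
          have hε' : (0 : ℝ) < ε := by exact_mod_cast hε
          have hC0 : (0 : ℝ) ≤ C := C.2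
          push_cast
          have e : (C : ℝ) * (ε / (2 * (C + 1)) + ε / (2 * (C + 1))) = ε * (C / (C + 1)) := by
            field_simp; ring
          rw [e]
          have : (C : ℝ) / (C + 1) < 1 := by rw [div_lt_one (by positivity)]; linarith
          nlinarith)
    (by
      rintro _ ⟨ε, hε, rfl⟩
      exact ⟨_, ⟨ε, hε, rfl⟩, fun f hf => (hneg f).trans_lt hf⟩)

variable (𝕜 : Type*) [RCLike 𝕜]

section Functional

variable {𝕜} {μ : Measure α} {ρ : (α → ℝ≥0∞) → ℝ≥0∞}

/-- The quasi-norm `‖f‖ = ρ(|f|)` of a class of measurable functions. -/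
noncomputable def qnorm (ρ : (α → ℝ≥0∞) → ℝ≥0∞) (f : α →ₘ[μ] 𝕜) : ℝ≥0∞ :=
  ρ fun x => ‖f x‖ₑ

theorem aemeasurable_enorm (f : α →ₘ[μ] 𝕜) : AEMeasurable (fun x => ‖f x‖ₑ) μ :=
  f.aestronglyMeasurable.enorm

theorem IsLatticeQuasiNormWith.congr {C : ℝ≥0} (h : IsLatticeQuasiNormWith μ C ρ)
    {f g : α → ℝ≥0∞} (hf : AEMeasurable f μ) (hg : AEMeasurable g μ) (hfg : f =ᵐ[μ] g) :
    ρ f = ρ g :=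
  le_antisymm (h.mono _ _ hg hf hfg.le) (h.mono _ _ hf hg hfg.symm.le)

theorem IsLatticeQuasiNormWith.qnorm_zero {C : ℝ≥0} (h : IsLatticeQuasiNormWith μ C ρ) :
    qnorm ρ (0 : α →ₘ[μ] 𝕜) = 0 := by
  refine (h.eq_zero_iff _ (aemeasurable_enorm _)).2 ?_
  filter_upwards [AEEqFun.coeFn_zero (α := α) (β := 𝕜) (μ := μ)] with x hx
  simp [hx]

theorem IsLatticeQuasiNormWith.qnorm_add_le {C : ℝ≥0} (h : IsLatticeQuasiNormWith μ C ρ)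
    (f g : α →ₘ[μ] 𝕜) : qnorm ρ (f + g) ≤ C * (qnorm ρ f + qnorm ρ g) := by
  refine le_trans (h.mono _ _ ((aemeasurable_enorm f).add (aemeasurable_enorm g))
    (aemeasurable_enorm _) ?_) (h.add_le _ _ (aemeasurable_enorm f) (aemeasurable_enorm g))
  filter_upwards [AEEqFun.coeFn_add f g] with x hx
  simpa [hx] using enorm_add_le (f x) (g x)

theorem IsLatticeQuasiNormWith.qnorm_smul {C : ℝ≥0} (h : IsLatticeQuasiNormWith μ C ρ)
    (c : 𝕜) (f : α →ₘ[μ] 𝕜) : qnorm ρ (c • f) = ‖c‖ₑ * qnorm ρ f := by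
  refine Eq.trans (h.congr (aemeasurable_enorm _) ((aemeasurable_enorm f).const_mul _) ?_)
    (h.const_mul ‖c‖₊ _ (aemeasurable_enorm f))
  filter_upwards [AEEqFun.coeFn_smul c f] with x hx
  simp [hx, enorm_eq_nnnorm]

end Functional

variable {μ : Measure α} {ρ : (α → ℝ≥0∞) → ℝ≥0∞}

/-- The quasi-Banach function lattice `X(ρ)`: the (classes of) `𝕜`-valued measurable functions
with `ρ(|f|) < ∞`. -/
def space (hρ : IsLatticeQuasiNorm μ ρ) : Submodule 𝕜 (α →ₘ[μ] 𝕜) where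
  carrier := {f | qnorm ρ f < ∞}
  zero_mem' := by
    obtain ⟨C, -, h⟩ := hρ
    simp [h.qnorm_zero]
  add_mem' := by
    obtain ⟨C, -, h⟩ := hρ
    intro f g hf hg
    exact (h.qnorm_add_le f g).trans_lt
      (ENNReal.mul_lt_top ENNReal.coe_lt_top (ENNReal.add_lt_top.2 ⟨hf, hg⟩))
  smul_mem' := by
    obtain ⟨C, -, h⟩ := hρ
    intro c f hf
    simp only [mem_ofPred_eq, h.qnorm_smul] at hf ⊢
    exact ENNReal.mul_lt_top enorm_lt_top hf

/-- The topology of `X(ρ)` given by its quasi-norm. -/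
noncomputable instance instTopologicalSpaceSpace (hρ : IsLatticeQuasiNorm μ ρ) : TopologicalSpace (space 𝕜 hρ) :=
  (quasiNormBasis (fun f : space 𝕜 hρ => qnorm ρ (f : α →ₘ[μ] 𝕜))
    (by obtain ⟨C, -, h⟩ := hρ; exact h.qnorm_zero)
    (by
      obtain ⟨C, -, h⟩ := hρ
      intro f
      have e : (-1 : 𝕜) • (f : α →ₘ[μ] 𝕜) = -(f : α →ₘ[μ] 𝕜) := by
        have := neg_one_smul 𝕜 (f : α →ₘ[μ] 𝕜)
        exact this
      have := h.qnorm_smul (-1 : 𝕜) (f : α →ₘ[μ] 𝕜)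
      rw [e, enorm_neg, enorm_one, one_mul] at this
      exact this.le)
    (by
      obtain ⟨C, -, h⟩ := hρ
      exact ⟨C, fun f g => h.qnorm_add_le _ _⟩)).topology

/-- `E_n → ∅` `μ`-a.e. for a sequence of measurable sets. -/
def TendstoEmpty (μ : Measure α) (E : ℕ → Set α) : Prop :=
  (∀ n, MeasurableSet (E n)) ∧ μ (⋂ n, ⋃ m ≥ n, E m) = 0

/-- `‖f χ_E‖ = ρ(|f| χ_E)`. -/
noncomputable def qnormOn {𝕜 : Type*} [RCLike 𝕜] (ρ : (α → ℝ≥0∞) → ℝ≥0∞) (f : α →ₘ[μ] 𝕜)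
    (E : Set α) : ℝ≥0∞ :=
  ρ (E.indicator fun x => ‖f x‖ₑ)

/-- The set `X_a` of functions of absolutely continuous quasi-norm in `X = X(ρ)`. -/
def acPart (hρ : IsLatticeQuasiNorm μ ρ) : Set (α →ₘ[μ] 𝕜) :=
  {f | f ∈ space 𝕜 hρ ∧ ∀ E : ℕ → Set α, TendstoEmpty μ E →
    Tendsto (fun n => qnormOn ρ f (E n)) atTop (𝓝 0)}

variable {𝕜}

/-- `K ⊆ X_a` has uniformly absolutely continuous quasi-norm in `X = X(ρ)`. -/
def IsUAC (hρ : IsLatticeQuasiNorm μ ρ) (K : Set (α →ₘ[μ] 𝕜)) : Prop :=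
  K ⊆ acPart 𝕜 hρ ∧ ∀ E : ℕ → Set α, TendstoEmpty μ E →
    ∀ ε : ℝ≥0∞, 0 < ε → ∃ N : ℕ, ∀ f ∈ K, ∀ n ≥ N, qnormOn ρ f (E n) < ε

end Abstract

section Besov

variable {𝕜 : Type*} [RCLike 𝕜] {n : ℕ}

/-- The modulus of continuity `ω_L(f, t) = sup_{|h| ≤ t} ‖f(· + h) - f‖_L`. -/
noncomputable def modulus (L : (EuclideanSpace ℝ (Fin n) → ℝ≥0∞) → ℝ≥0∞)
    (f : EuclideanSpace ℝ (Fin n) →ₘ[volume] 𝕜) (t : ℝ) : ℝ≥0∞ :=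
  ⨆ (h : EuclideanSpace ℝ (Fin n)) (_ : ‖h‖ ≤ t), L fun x => ‖f (x + h) - f x‖ₑ

/-- The Besov quasi-norm `‖f‖_L + ‖ω_L(f, ·)‖_Y`. -/
noncomputable def besovNorm (L : (EuclideanSpace ℝ (Fin n) → ℝ≥0∞) → ℝ≥0∞)
    (Y : (ℝ → ℝ≥0∞) → ℝ≥0∞) (f : EuclideanSpace ℝ (Fin n) →ₘ[volume] 𝕜) : ℝ≥0∞ :=
  qnorm L f + Y (modulus L f)

variable {L : (EuclideanSpace ℝ (Fin n) → ℝ≥0∞) → ℝ≥0∞} {Y : (ℝ → ℝ≥0∞) → ℝ≥0∞}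

theorem modulus_mono (f : EuclideanSpace ℝ (Fin n) →ₘ[volume] 𝕜) : Monotone (modulus L f) :=
  fun _ _ hst => iSup_mono fun _ => iSup_mono' fun hh => ⟨hh.trans hst, le_rfl⟩

theorem aemeasurable_modulus (f : EuclideanSpace ℝ (Fin n) →ₘ[volume] 𝕜) (ν : Measure ℝ) :
    AEMeasurable (modulus L f) ν :=
  (modulus_mono f).measurable.aemeasurable

theorem ae_shift (h : EuclideanSpace ℝ (Fin n)) {p : EuclideanSpace ℝ (Fin n) → Prop}
    (hp : ∀ᵐ x, p x) : ∀ᵐ x, p (x + h) :=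
  (measurePreserving_add_right volume h).quasiMeasurePreserving.ae hp

theorem aemeasurable_diff (f : EuclideanSpace ℝ (Fin n) →ₘ[volume] 𝕜)
    (h : EuclideanSpace ℝ (Fin n)) : AEMeasurable (fun x => ‖f (x + h) - f x‖ₑ) volume :=
  ((f.aestronglyMeasurable.comp_quasiMeasurePreserving
    (measurePreserving_add_right volume h).quasiMeasurePreserving).sub
      f.aestronglyMeasurable).enorm

theorem modulus_zero {C : ℝ≥0} (hL : IsLatticeQuasiNormWith volume C L) (t : ℝ) :
    modulus L (0 : EuclideanSpace ℝ (Fin n) →ₘ[volume] 𝕜) t = 0 := by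
  simp only [modulus, ENNReal.iSup_eq_zero]
  intro h _
  refine (hL.eq_zero_iff _ (aemeasurable_diff _ _)).2 ?_
  have h0 := AEEqFun.coeFn_zero (α := EuclideanSpace ℝ (Fin n)) (β := 𝕜) (μ := volume)
  filter_upwards [h0, ae_shift h h0] with x hx hx'
  simp [hx, hx']

theorem modulus_add_le {C : ℝ≥0} (hL : IsLatticeQuasiNormWith volume C L)
    (f g : EuclideanSpace ℝ (Fin n) →ₘ[volume] 𝕜) (t : ℝ) :
    modulus L (f + g) t ≤ C * (modulus L f t + modulus L g t) := by
  refine iSup₂_le fun h hh => ?_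
  have hf : L (fun x => ‖f (x + h) - f x‖ₑ) ≤ modulus L f t :=
    le_iSup₂ (f := fun h (_ : ‖h‖ ≤ t) => L fun x => ‖f (x + h) - f x‖ₑ) h hh
  have hg : L (fun x => ‖g (x + h) - g x‖ₑ) ≤ modulus L g t :=
    le_iSup₂ (f := fun h (_ : ‖h‖ ≤ t) => L fun x => ‖g (x + h) - g x‖ₑ) h hh
  refine le_trans (hL.mono _ _ ((aemeasurable_diff f h).add (aemeasurable_diff g h))
    (aemeasurable_diff _ _) ?_) ((hL.add_le _ _ (aemeasurable_diff f h)
      (aemeasurable_diff g h)).trans (by gcongr))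
  have h0 := AEEqFun.coeFn_add f g
  filter_upwards [h0, ae_shift h h0] with x hx hx'
  simp only [hx, hx', Pi.add_apply]
  rw [add_sub_add_comm]
  exact enorm_add_le _ _

theorem modulus_smul_le {C : ℝ≥0} (hL : IsLatticeQuasiNormWith volume C L)
    (c : 𝕜) (f : EuclideanSpace ℝ (Fin n) →ₘ[volume] 𝕜) (t : ℝ) :
    modulus L (c • f) t ≤ ‖c‖ₑ * modulus L f t := by
  refine iSup₂_le fun h hh => ?_
  have hf : L (fun x => ‖f (x + h) - f x‖ₑ) ≤ modulus L f t :=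
    le_iSup₂ (f := fun h (_ : ‖h‖ ≤ t) => L fun x => ‖f (x + h) - f x‖ₑ) h hh
  refine le_trans (hL.mono _ _ ((aemeasurable_diff f h).const_mul _)
    (aemeasurable_diff _ _) ?_) ((hL.const_mul ‖c‖₊ _ (aemeasurable_diff f h)).le.trans
      (mul_le_mul_right hf _))
  have h0 := AEEqFun.coeFn_smul c f
  filter_upwards [h0, ae_shift h h0] with x hx hx'
  simp only [hx, hx', Pi.smul_apply]
  rw [← smul_sub, enorm_smul]
  rfl

theorem besovNorm_zero (hL : IsLatticeQuasiNorm volume L)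
    (hY : IsLatticeQuasiNorm (volume.restrict (Ioo (0 : ℝ) 1)) Y) :
    besovNorm L Y (0 : EuclideanSpace ℝ (Fin n) →ₘ[volume] 𝕜) = 0 := by
  obtain ⟨C, -, hL⟩ := hL
  obtain ⟨D, -, hY⟩ := hY
  have := (hY.eq_zero_iff _ (aemeasurable_modulus
    (L := L) (0 : EuclideanSpace ℝ (Fin n) →ₘ[volume] 𝕜) _)).2
    (Eventually.of_forall fun t => modulus_zero hL t)
  simp [besovNorm, hL.qnorm_zero, this]

theorem besovNorm_add_le (hL : IsLatticeQuasiNorm volume L)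
    (hY : IsLatticeQuasiNorm (volume.restrict (Ioo (0 : ℝ) 1)) Y) :
    ∃ C : ℝ≥0, ∀ f g : EuclideanSpace ℝ (Fin n) →ₘ[volume] 𝕜,
      besovNorm L Y (f + g) ≤ C * (besovNorm L Y f + besovNorm L Y g) := by
  obtain ⟨C, -, hL⟩ := hL
  obtain ⟨D, hD, hY⟩ := hY
  refine ⟨C * D, fun f g => ?_⟩
  have hmf := aemeasurable_modulus (L := L) f (volume.restrict (Ioo (0 : ℝ) 1))
  have hmg := aemeasurable_modulus (L := L) g (volume.restrict (Ioo (0 : ℝ) 1))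
  have h1 : Y (modulus L (f + g)) ≤ C * (D * (Y (modulus L f) + Y (modulus L g))) :=
    calc Y (modulus L (f + g))
        ≤ Y (fun t => (C : ℝ≥0∞) * (modulus L f t + modulus L g t)) :=
          hY.mono _ _ ((hmf.add hmg).const_mul _) (aemeasurable_modulus _ _)
            (Eventually.of_forall fun t => modulus_add_le hL f g t)
      _ = C * Y (fun t => modulus L f t + modulus L g t) := hY.const_mul C _ (hmf.add hmg)
      _ ≤ C * (D * (Y (modulus L f) + Y (modulus L g))) := by
          gcongr; exact hY.add_le _ _ hmf hmg
  have h2 : qnorm L (f + g) ≤ C * (D * (qnorm L f + qnorm L g)) := by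
    refine (hL.qnorm_add_le f g).trans ?_
    gcongr
    exact le_mul_of_one_le_left (zero_le) (by exact_mod_cast hD)
  calc besovNorm L Y (f + g)
      ≤ C * (D * (qnorm L f + qnorm L g)) + C * (D * (Y (modulus L f) + Y (modulus L g))) :=
        add_le_add h2 h1
    _ = ((C * D : ℝ≥0) : ℝ≥0∞) * (besovNorm L Y f + besovNorm L Y g) := by
        simp only [besovNorm, ENNReal.coe_mul]; ring

theorem besovNorm_smul_le (hL : IsLatticeQuasiNorm volume L)
    (hY : IsLatticeQuasiNorm (volume.restrict (Ioo (0 : ℝ) 1)) Y)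
    (c : 𝕜) (f : EuclideanSpace ℝ (Fin n) →ₘ[volume] 𝕜) :
    besovNorm L Y (c • f) ≤ ‖c‖ₑ * besovNorm L Y f := by
  obtain ⟨C, -, hL⟩ := hL
  obtain ⟨D, -, hY⟩ := hY
  have hmf := aemeasurable_modulus (L := L) f (volume.restrict (Ioo (0 : ℝ) 1))
  rw [besovNorm, besovNorm, mul_add, hL.qnorm_smul]
  gcongr
  exact (hY.mono _ _ (hmf.const_mul _) (aemeasurable_modulus _ _)
    (Eventually.of_forall fun t => modulus_smul_le hL c f t)).trans (hY.const_mul ‖c‖₊ _ hmf).le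

variable (𝕜) in
/-- The abstract Besov space `B(L, Y)`. (It is used with `‖1‖_Y = ∞`.) -/
def besov (hL : IsLatticeQuasiNorm volume L)
    (hY : IsLatticeQuasiNorm (volume.restrict (Ioo (0 : ℝ) 1)) Y) :
    Submodule 𝕜 (EuclideanSpace ℝ (Fin n) →ₘ[volume] 𝕜) where
  carrier := {f | f ∈ space 𝕜 hL ∧ besovNorm L Y f < ∞}
  zero_mem' := ⟨zero_mem _, by simp [besovNorm_zero hL hY]⟩
  add_mem' := by
    rintro f g ⟨hf, hf'⟩ ⟨hg, hg'⟩
    obtain ⟨C, hC⟩ := besovNorm_add_le (𝕜 := 𝕜) hL hY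
    exact ⟨add_mem hf hg, (hC f g).trans_lt
      (ENNReal.mul_lt_top ENNReal.coe_lt_top (ENNReal.add_lt_top.2 ⟨hf', hg'⟩))⟩
  smul_mem' := by
    rintro c f ⟨hf, hf'⟩
    exact ⟨Submodule.smul_mem _ c hf, (besovNorm_smul_le hL hY c f).trans_lt
      (ENNReal.mul_lt_top enorm_lt_top hf')⟩

/-- The topology of `B(L, Y)` given by its quasi-norm. -/
noncomputable instance instTopologicalSpaceBesov (hL : IsLatticeQuasiNorm volume L)
    (hY : IsLatticeQuasiNorm (volume.restrict (Ioo (0 : ℝ) 1)) Y) :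
    TopologicalSpace (besov 𝕜 hL hY) :=
  (quasiNormBasis
    (fun f : besov 𝕜 hL hY => besovNorm L Y (f : EuclideanSpace ℝ (Fin n) →ₘ[volume] 𝕜))
    (besovNorm_zero hL hY)
    (fun f => by
      have e : (-1 : 𝕜) • (f : EuclideanSpace ℝ (Fin n) →ₘ[volume] 𝕜) = -f := by
        have := neg_one_smul 𝕜 (f : EuclideanSpace ℝ (Fin n) →ₘ[volume] 𝕜)
        exact this
      have := besovNorm_smul_le hL hY (-1 : 𝕜) (f : EuclideanSpace ℝ (Fin n) →ₘ[volume] 𝕜)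
      rw [e, enorm_neg, enorm_one, one_mul] at this
      exact this)
    (by
      obtain ⟨C, hC⟩ := besovNorm_add_le (𝕜 := 𝕜) hL hY
      exact ⟨C, fun f g => hC _ _⟩)).topology

/-- Restriction `f ↦ f|_Ω`. Measurable functions on `Ω` modulo null sets are represented as
classes with respect to Lebesgue measure restricted to `Ω`. -/
noncomputable def restr (Ω : Set (EuclideanSpace ℝ (Fin n))) :
    (EuclideanSpace ℝ (Fin n) →ₘ[volume] 𝕜) →ₗ[𝕜]
      (EuclideanSpace ℝ (Fin n) →ₘ[volume.restrict Ω] 𝕜) where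
  toFun f := AEEqFun.mk f f.aestronglyMeasurable.restrict
  map_add' f g := by
    rw [AEEqFun.mk_add_mk, AEEqFun.mk_eq_mk]
    exact ae_restrict_of_ae (AEEqFun.coeFn_add f g)
  map_smul' c f := by
    rw [RingHom.id_apply, AEEqFun.smul_mk, AEEqFun.mk_eq_mk]
    exact ae_restrict_of_ae (AEEqFun.coeFn_smul c f)

/-- The restriction operator from `B(L, Y)` into `Z(Ω)`, when it is well defined. -/
noncomputable def besovRestr {Ω : Set (EuclideanSpace ℝ (Fin n))}
    {Z : (EuclideanSpace ℝ (Fin n) → ℝ≥0∞) → ℝ≥0∞}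
    (hL : IsLatticeQuasiNorm volume L)
    (hY : IsLatticeQuasiNorm (volume.restrict (Ioo (0 : ℝ) 1)) Y)
    (hZ : IsLatticeQuasiNorm (volume.restrict Ω) Z)
    (hmap : ∀ f ∈ besov 𝕜 hL hY, restr Ω f ∈ space 𝕜 hZ) :
    besov 𝕜 hL hY →ₗ[𝕜] space 𝕜 hZ :=
  ((restr Ω).domRestrict (besov 𝕜 hL hY)).codRestrict (space 𝕜 hZ) fun f => hmap f f.2

end Besov

end QBFS

/-!
The unit ball of `B(L, Y)` is always relatively compact for convergence in measure on bounded sets;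
uniform absolute continuity is exactly what upgrades this to compactness in `Z(Ω)`.

Since `‖1‖_Y = ∞` and `Y` has the Fatou property, `‖χ_[t,1)‖_Y → ∞` as `t → 0`. A modulus of
continuity is monotone, so `‖ω_L(f, ·)‖_Y ≤ 1` forces `ω_L(f, t) → 0` uniformly in `f`
(`exists_forall_monotone_le`). As `L` is a power space, `∫_E |f|^b ≤ c_E ‖f‖_L ^ b` on sets `E` of
finite measure, for some `b ∈ (0, 1]`
(`IsPowerQBFS.exists_lintegral_rpow_le`). For `b < 1` the functions in `L` need not be locally
integrable; composing with the bounded Lipschitz homeomorphism `z ↦ z / (1 + |z|)` turns the unit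
ball into a uniformly bounded family that is equicontinuous under translations in `L¹` of balls.
For such families a Kolmogorov–Riesz argument applies (`exists_subseq_tendsto_ae_of_bounded`):
along a weakly convergent subsequence in `L²` the averages over small balls converge pointwise, and
they are uniformly close to the functions. The bound on `∫_E |f|^b` and Fatou's lemma keep the
limit strictly inside the unit ball almost everywhere, so the truncation can be undone
(`exists_subseq_tendsto_ae_of_besovNorm_le`).

If the restrictions to `Ω` have uniformly absolutely continuous quasi-norm, an almost everywhere
convergent sequence of them is Cauchy in `Z(Ω)`: off the set where two of its late terms differ by
more than `δ`, the difference is at most `δ ‖1‖`, and on that set uniform absolute continuity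
applies. The Fatou property of `Z` identifies the limit (`IsUAC.exists_tendsto_qnorm_sub`).
Conversely, a relatively compact subset of `X_a` has uniformly absolutely continuous quasi-norm, by
approximating along a convergent subsequence with one fixed member
(`isUAC_of_forall_mem_isCompact`).
-/

namespace QBFS

/-! ### Compactness in measure of translation-equicontinuous sequences -/

section Compactness

variable {𝕜 : Type*} [RCLike 𝕜]

/-- Weak sequential compactness of balls in `L²`, tested on indicator functions. -/
theorem exists_subseq_tendsto_setIntegral {α : Type*} [MeasurableSpace α]
    [MeasurableSpace.CountablyGenerated α] {μ : Measure α} [IsFiniteMeasure μ]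
    {g : ℕ → α → 𝕜} (hg : ∀ k, AEStronglyMeasurable (g k) μ) {M : ℝ}
    (hb : ∀ k x, ‖g k x‖ ≤ M) :
    ∃ φ : ℕ → ℕ, StrictMono φ ∧ ∀ s, MeasurableSet s →
      ∃ a : 𝕜, Tendsto (fun k => ∫ x in s, g (φ k) x ∂μ) atTop (𝓝 a) := by
  have hLp (k : ℕ) : MemLp (g k) 2 μ := .of_bound (hg k) M (.of_forall (hb k))
  have : Fact ((2 : ℝ≥0∞) ≠ ∞) := ⟨by simp⟩
  let v (k : ℕ) : Lp 𝕜 2 μ := (hLp k).toLp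
  let ℓ (k : ℕ) : WeakDual 𝕜 (Lp 𝕜 2 μ) := StrongDual.toWeakDual (innerSL 𝕜 (v k))
  obtain ⟨r, hr⟩ : ∃ r : ℝ, ∀ k, ‖v k‖ ≤ r := by
    refine ⟨(μ univ ^ (2 : ℝ≥0∞).toReal⁻¹ * ENNReal.ofReal M).toReal, fun k => ?_⟩
    rw [Lp.norm_toLp]
    refine ENNReal.toReal_mono ?_ (eLpNorm_le_of_ae_bound (.of_forall (hb k)))
    exact ENNReal.mul_ne_top (ENNReal.rpow_ne_top_of_nonneg (by simp) (measure_ne_top _ _))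
      ENNReal.ofReal_ne_top
  obtain ⟨ℓ', -, φ, hφ, hlim⟩ := WeakDual.isSeqCompact_closedBall 𝕜 (Lp 𝕜 2 μ) 0 r
    (x := ℓ) (fun k => by
      simp only [mem_preimage, Metric.mem_closedBall, dist_zero_right]
      change ‖innerSL 𝕜 (v k)‖ ≤ r
      rw [innerSL_apply_norm]
      exact hr k)
  refine ⟨φ, hφ, fun s hs => ?_⟩
  let w : Lp 𝕜 2 μ := indicatorConstLp 2 hs (measure_ne_top μ s) 1
  have h1 : Tendsto (fun k => ℓ (φ k) w) atTop (𝓝 (ℓ' w)) :=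
    ((WeakDual.eval_continuous w).tendsto ℓ').comp hlim
  -- The functionals are `⟪v k, ·⟫`, which is conjugate linear in `v k`.
  refine ⟨starRingEnd 𝕜 (ℓ' w), ?_⟩
  refine ((RCLike.continuous_conj.tendsto _).comp h1).congr fun k => ?_
  have h2 : ∫ x in s, g (φ k) x ∂μ = ∫ x in s, v (φ k) x ∂μ :=
    setIntegral_congr_ae hs ((hLp (φ k)).coeFn_toLp.mono fun x hx _ => hx.symm)
  rw [h2, ← L2.inner_indicatorConstLp_one hs (measure_ne_top μ s), ← inner_conj_symm]
  rfl

theorem exists_subseq_tendsto_ae_of_cauchy_lintegral {α : Type*} [MeasurableSpace α]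
    {μ : Measure α} [IsFiniteMeasure μ] {g : ℕ → α → 𝕜}
    (hg : ∀ k, AEStronglyMeasurable (g k) μ) {M : ℝ} (hb : ∀ k x, ‖g k x‖ ≤ M)
    (hc : ∀ ε : ℝ≥0, 0 < ε → ∃ N, ∀ j ≥ N, ∀ k ≥ N, ∫⁻ x, ‖g j x - g k x‖ₑ ∂μ ≤ ε) :
    ∃ φ : ℕ → ℕ, StrictMono φ ∧ ∃ G : α → 𝕜, ∀ᵐ x ∂μ,
      Tendsto (fun k => g (φ k) x) atTop (𝓝 (G x)) := by
  have hLp (k : ℕ) : MemLp (g k) 1 μ := .of_bound (hg k) M (.of_forall (hb k))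
  have hcauchy : CauchySeq fun k => (hLp k).toLp := by
    rw [EMetric.cauchySeq_iff]
    intro ε hε
    obtain ⟨δ, hδ, hδε⟩ := ENNReal.lt_iff_exists_nnreal_btwn.1 hε
    obtain ⟨N, hN⟩ := hc δ (by exact_mod_cast hδ)
    refine ⟨N, fun j hj k hk => ?_⟩
    rw [Lp.edist_toLp_toLp, eLpNorm_one_eq_lintegral_enorm]
    exact (hN j hj k hk).trans_lt hδε
  obtain ⟨G, hG⟩ := cauchySeq_tendsto_of_complete hcauchy
  obtain ⟨φ, hφ, h⟩ := (tendstoInMeasure_of_tendsto_Lp hG).exists_seq_tendsto_ae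
  refine ⟨φ, hφ, G, ?_⟩
  filter_upwards [h, ae_all_iff.2 fun k => (hLp k).coeFn_toLp] with x hx hx'
  simpa only [hx'] using hx

variable {E : Type*} [NormedAddCommGroup E] [NormedSpace ℝ E] [FiniteDimensional ℝ E]
  [MeasurableSpace E] [BorelSpace E] {μ : Measure E} [μ.IsAddHaarMeasure]

/-- A function that moves little under small translations, in `L¹(s)`, is close in `L¹(s)` to its
averages over small balls. Both sides carry the volume of the ball as a factor. -/
theorem lintegral_enorm_sub_setIntegral_le {g : E → 𝕜} (hg : StronglyMeasurable g)
    {M : ℝ} (hb : ∀ x, ‖g x‖ ≤ M) (s : Set E) {r : ℝ} {ε : ℝ≥0∞}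
    (h : ∀ z ∈ Metric.ball (0 : E) r, ∫⁻ x in s, ‖g (x + z) - g x‖ₑ ∂μ ≤ ε) :
    ∫⁻ x in s, ‖μ.real (Metric.ball 0 r) • g x - ∫ y in Metric.ball x r, g y ∂μ‖ₑ ∂μ
      ≤ μ (Metric.ball 0 r) * ε := by
  have hshift (x : E) :
      ∫ y in Metric.ball x r, g y ∂μ = ∫ z in Metric.ball 0 r, g (x + z) ∂μ := by
    rw [← (measurePreserving_add_left μ x).setIntegral_preimage_emb
      (measurableEmbedding_addLeft x)]
    congr 2
    ext z
    simp
  have hint (x : E) : IntegrableOn (fun z => g (x + z)) (Metric.ball 0 r) μ :=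
    .of_bound measure_ball_lt_top
      (hg.comp_measurable (measurable_const_add x)).aestronglyMeasurable M
      (.of_forall fun z => hb _)
  have hpt (x : E) : ‖μ.real (Metric.ball 0 r) • g x - ∫ y in Metric.ball x r, g y ∂μ‖ₑ
      ≤ ∫⁻ z in Metric.ball 0 r, ‖g (x + z) - g x‖ₑ ∂μ := by
    rw [hshift, ← setIntegral_const, ← enorm_neg, neg_sub,
      ← integral_sub (hint x) (integrableOn_const measure_ball_lt_top.ne)]
    exact enorm_integral_le_lintegral_enorm _
  calc ∫⁻ x in s, ‖μ.real (Metric.ball 0 r) • g x - ∫ y in Metric.ball x r, g y ∂μ‖ₑ ∂μ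
      ≤ ∫⁻ x in s, ∫⁻ z in Metric.ball 0 r, ‖g (x + z) - g x‖ₑ ∂μ ∂μ :=
        lintegral_mono fun x => hpt x
    _ = ∫⁻ z in Metric.ball 0 r, ∫⁻ x in s, ‖g (x + z) - g x‖ₑ ∂μ ∂μ := by
        refine lintegral_lintegral_swap ?_
        have h1 : StronglyMeasurable fun p : E × E => g (p.1 + p.2) - g p.1 :=
          (hg.comp_measurable measurable_add).sub (hg.comp_measurable measurable_fst)
        exact h1.enorm.aemeasurable
    _ ≤ ∫⁻ z in Metric.ball 0 r, ε ∂μ := setLIntegral_mono measurable_const h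
    _ = μ (Metric.ball 0 r) * ε := by rw [setLIntegral_const, mul_comm]

theorem stronglyMeasurable_setIntegral_ball {g : E → 𝕜} (hg : StronglyMeasurable g) (r : ℝ) :
    StronglyMeasurable fun x => ∫ y in Metric.ball x r, g y ∂μ := by
  have h : (fun x => ∫ y in Metric.ball x r, g y ∂μ) =
      fun x => ∫ y, {p : E × E | dist p.2 p.1 < r}.indicator (fun p => g p.2) (x, y) ∂μ := by
    ext x
    rw [← integral_indicator Metric.isOpen_ball.measurableSet]
    rfl
  rw [h]
  exact ((hg.comp_measurable measurable_snd).indicator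
    (measurableSet_lt (measurable_snd.dist measurable_fst) measurable_const)).integral_prod_right'

/-- A Kolmogorov–Riesz theorem: a uniformly bounded sequence that is equicontinuous under
translations in `L¹` of a ball has a subsequence converging almost everywhere on that ball. -/
theorem exists_subseq_tendsto_ae_of_bounded {g : ℕ → E → 𝕜}
    (hg : ∀ k, StronglyMeasurable (g k)) {M : ℝ} (hb : ∀ k x, ‖g k x‖ ≤ M) (R : ℝ)
    (h : ∀ ε : ℝ≥0, 0 < ε → ∃ r > 0, ∀ k, ∀ z, ‖z‖ ≤ r →
      ∫⁻ x in Metric.ball 0 R, ‖g k (x + z) - g k x‖ₑ ∂μ ≤ ε) :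
    ∃ φ : ℕ → ℕ, StrictMono φ ∧ ∃ G : E → 𝕜, ∀ᵐ x ∂μ.restrict (Metric.ball 0 R),
      Tendsto (fun k => g (φ k) x) atTop (𝓝 (G x)) := by
  have hfin (S : ℝ) : IsFiniteMeasure (μ.restrict (Metric.ball 0 S)) :=
    isFiniteMeasure_restrict.2 measure_ball_lt_top.ne
  obtain ⟨φ, hφ, hlim⟩ := exists_subseq_tendsto_setIntegral
    (μ := μ.restrict (Metric.ball 0 (R + 1))) (fun k => (hg k).aestronglyMeasurable) hb
  suffices hc : ∀ ε : ℝ≥0, 0 < ε → ∃ N, ∀ j ≥ N, ∀ k ≥ N,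
      ∫⁻ x in Metric.ball 0 R, ‖g (φ j) x - g (φ k) x‖ₑ ∂μ ≤ ε by
    obtain ⟨ψ, hψ, G, hG⟩ := exists_subseq_tendsto_ae_of_cauchy_lintegral
      (fun k => (hg (φ k)).aestronglyMeasurable) (fun k => hb (φ k)) hc
    exact ⟨φ ∘ ψ, hφ.comp hψ, G, hG⟩
  intro ε hε
  obtain ⟨r₀, hr₀, hr₀'⟩ := h (ε / 4) (by positivity)
  -- With radius at most `1`, the averaging balls stay inside `Metric.ball 0 (R + 1)`.
  set r := min r₀ 1
  have hr : 0 < r := lt_min hr₀ one_pos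
  set V := μ (Metric.ball (0 : E) r)
  have hV : V ≠ ∞ := measure_ball_lt_top.ne
  have hV0 : V ≠ 0 := (Metric.measure_ball_pos μ 0 hr).ne'
  let I (k : ℕ) (x : E) : 𝕜 := ∫ y in Metric.ball x r, g (φ k) y ∂μ
  have hI (k : ℕ) : StronglyMeasurable (I k) := stronglyMeasurable_setIntegral_ball (hg _) r
  have hgI (k : ℕ) : ∫⁻ x in Metric.ball 0 R, ‖μ.real (Metric.ball 0 r) • g (φ k) x - I k x‖ₑ ∂μ
      ≤ V * ((ε / 4 : ℝ≥0) : ℝ≥0∞) :=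
    lintegral_enorm_sub_setIntegral_le (hg _) (hb _) _ fun z hz =>
      hr₀' _ _ ((mem_ball_zero_iff.1 hz).le.trans (min_le_left _ _))
  have hIlim (x : E) : ∃ a : 𝕜, x ∈ Metric.ball (0 : E) R →
      Tendsto (fun k => I k x) atTop (𝓝 a) := by
    obtain ⟨a, ha⟩ := hlim (Metric.ball x r) Metric.isOpen_ball.measurableSet
    refine ⟨a, fun hx => ?_⟩
    rw [Measure.restrict_restrict Metric.isOpen_ball.measurableSet,
      inter_eq_self_of_subset_left] at ha
    · exact ha
    · refine Metric.ball_subset_ball' ?_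
      rw [dist_zero_right]
      have := mem_ball_zero_iff.1 hx
      have := min_le_right r₀ 1
      linarith
  choose a ha using hIlim
  have haelim : ∀ᵐ x ∂μ.restrict (Metric.ball 0 R), Tendsto (fun k => I k x) atTop (𝓝 (a x)) :=
    (ae_restrict_mem Metric.isOpen_ball.measurableSet).mono fun x hx => ha x hx
  have ham : AEStronglyMeasurable a (μ.restrict (Metric.ball 0 R)) :=
    aestronglyMeasurable_of_tendsto_ae atTop (fun k => (hI k).aestronglyMeasurable) haelim
  have hIbound (k : ℕ) (x : E) : ‖I k x‖ ≤ M * V.toReal := by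
    refine (norm_setIntegral_le_of_norm_le_const measure_ball_lt_top fun y _ => hb _ y).trans ?_
    rw [Measure.real, Measure.addHaar_ball_center]
  -- Pointwise convergence of the averages and their uniform bound give convergence in `L¹`.
  have hIa : Tendsto (fun k => ∫⁻ x in Metric.ball 0 R, ‖I k x - a x‖ₑ ∂μ) atTop (𝓝 0) := by
    have hsub : ∀ᵐ x ∂μ.restrict (Metric.ball 0 R), ‖a x‖ ≤ M * V.toReal :=
      haelim.mono fun x hx => le_of_tendsto hx.norm (.of_forall fun k => hIbound k x)
    have := tendsto_lintegral_of_dominated_convergence' (μ := μ.restrict (Metric.ball 0 R))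
      (F := fun k x => ‖I k x - a x‖ₑ) (f := fun _ => 0)
      (fun _ => ENNReal.ofReal (M * V.toReal + M * V.toReal))
      (fun k => ((hI k).aestronglyMeasurable.sub ham).enorm)
      (fun k => hsub.mono fun x hx => by
        change ‖I k x - a x‖ₑ ≤ ENNReal.ofReal (M * V.toReal + M * V.toReal)
        rw [← ofReal_norm]
        exact ENNReal.ofReal_le_ofReal
          ((norm_sub_le _ _).trans (add_le_add (hIbound k x) hx)))
      (by
        rw [lintegral_const]
        exact ENNReal.mul_ne_top ENNReal.ofReal_ne_top (measure_ne_top _ _))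
      (haelim.mono fun x hx => by
        simpa using (hx.sub_const (a x)).enorm)
    simpa using this
  have hVε : 0 < V * ((ε / 4 : ℝ≥0) : ℝ≥0∞) :=
    ENNReal.mul_pos hV0 (by exact_mod_cast (show ε / 4 ≠ 0 by positivity))
  obtain ⟨N, hN⟩ := ENNReal.tendsto_atTop_zero.1 hIa _ hVε
  refine ⟨N, fun j hj k hk => ?_⟩
  have hsmul (k : ℕ) : StronglyMeasurable fun x =>
      μ.real (Metric.ball 0 r) • g (φ k) x - I k x := ((hg _).const_smul _).sub (hI k)
  rw [← ENNReal.mul_le_mul_iff_right hV0 hV]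
  calc V * ∫⁻ x in Metric.ball 0 R, ‖g (φ j) x - g (φ k) x‖ₑ ∂μ
      = ∫⁻ x in Metric.ball 0 R, V * ‖g (φ j) x - g (φ k) x‖ₑ ∂μ :=
        (lintegral_const_mul' _ _ hV).symm
    _ ≤ ∫⁻ x in Metric.ball 0 R, ((‖μ.real (Metric.ball 0 r) • g (φ j) x - I j x‖ₑ
          + ‖μ.real (Metric.ball 0 r) • g (φ k) x - I k x‖ₑ)
          + (‖I j x - a x‖ₑ + ‖I k x - a x‖ₑ)) ∂μ := by
        refine lintegral_mono fun x => ?_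
        have e : V = ‖μ.real (Metric.ball (0 : E) r)‖ₑ := by
          rw [Real.enorm_of_nonneg measureReal_nonneg, Measure.real, ENNReal.ofReal_toReal hV]
        rw [e, ← enorm_smul]
        calc _ = ‖((μ.real (Metric.ball 0 r) • g (φ j) x - I j x)
                - (μ.real (Metric.ball 0 r) • g (φ k) x - I k x))
                + ((I j x - a x) - (I k x - a x))‖ₑ := by
              congr 1
              rw [smul_sub]
              abel
          _ ≤ _ := (enorm_add_le _ _).trans (add_le_add enorm_sub_le enorm_sub_le)
    _ = _ := by
        have h1 := fun k => (hsmul k).enorm.aemeasurable (μ := μ.restrict (Metric.ball 0 R))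
        have h2 := fun k => ((hI k).aestronglyMeasurable.sub ham).enorm
        refine (lintegral_add_left' ((h1 j).add (h1 k)) _).trans (congrArg₂ _ ?_ ?_)
        · exact lintegral_add_left' (h1 j) _
        · exact lintegral_add_left' (h2 j) _
    _ ≤ (V * ((ε / 4 : ℝ≥0) : ℝ≥0∞) + V * ((ε / 4 : ℝ≥0) : ℝ≥0∞))
          + (V * ((ε / 4 : ℝ≥0) : ℝ≥0∞) + V * ((ε / 4 : ℝ≥0) : ℝ≥0∞)) :=
        add_le_add (add_le_add (hgI j) (hgI k)) (add_le_add (hN j hj) (hN k hk))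
    _ = V * ε := by
        simp only [← mul_add, ← ENNReal.coe_add]
        congr 2
        ring

end Compactness


/-! ### Quasi-norm topologies -/

section Topology

theorem nhds_zero_quasiNormBasis {E : Type*} [AddCommGroup E] (N : E → ℝ≥0∞) (h0 : N 0 = 0)
    (hneg : ∀ f, N (-f) ≤ N f) (hadd : ∃ C : ℝ≥0, ∀ f g, N (f + g) ≤ C * (N f + N g)) :
    @nhds E (quasiNormBasis N h0 hneg hadd).topology 0 = comap N (𝓝 0) := by
  refine (AddGroupFilterBasis.nhds_zero_hasBasis _).ext (ENNReal.nhds_zero_basis.comap N) ?_ ?_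
  · rintro _ ⟨ε, hε, rfl⟩
    exact ⟨ε, by exact_mod_cast hε, subset_rfl⟩
  · intro ε hε
    obtain ⟨δ, hδ, hδε⟩ := ENNReal.lt_iff_exists_nnreal_btwn.1 hε
    exact ⟨_, ⟨δ, by exact_mod_cast hδ, rfl⟩, fun f hf => lt_trans hf hδε⟩

theorem pseudoMetrizableSpace_of_nhds_zero {G : Type*} [AddCommGroup G] [TopologicalSpace G]
    [IsTopologicalAddGroup G] [(𝓝 (0 : G)).IsCountablyGenerated] :
    TopologicalSpace.PseudoMetrizableSpace G := by
  let _ : UniformSpace G := IsTopologicalAddGroup.rightUniformSpace G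
  have : IsUniformAddGroup G := isUniformAddGroup_of_addCommGroup
  have : (uniformity G).IsCountablyGenerated := IsUniformAddGroup.uniformity_countably_generated
  infer_instance

/-- The limits of the subsequences need not lie in `A`. -/
theorem isCompact_closure_of_forall_exists_subseq {X : Type*} [TopologicalSpace X]
    [TopologicalSpace.PseudoMetrizableSpace X] {A : Set X}
    (hA : ∀ u : ℕ → X, (∀ k, u k ∈ A) →
      ∃ φ : ℕ → ℕ, StrictMono φ ∧ ∃ x, Tendsto (u ∘ φ) atTop (𝓝 x)) :
    IsCompact (closure A) := by
  let _ := TopologicalSpace.pseudoMetrizableSpacePseudoMetric X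
  refine IsSeqCompact.isCompact fun v hv => ?_
  choose u huA hu using fun k => Metric.mem_closure_iff.1 (hv k) _ (Nat.one_div_pos_of_nat (n := k))
  obtain ⟨φ, hφ, x, hx⟩ := hA u huA
  have hvx : Tendsto (v ∘ φ) atTop (𝓝 x) := by
    rw [tendsto_iff_dist_tendsto_zero] at hx ⊢
    have h1 := (tendsto_one_div_add_atTop_nhds_zero_nat (𝕜 := ℝ)).comp hφ.tendsto_atTop
    refine squeeze_zero (fun _ => dist_nonneg) (fun k => ?_) (by simpa using h1.add hx)
    exact (dist_triangle _ (u (φ k)) _).trans (add_le_add (by simpa using (hu (φ k)).le) le_rfl)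
  exact ⟨x, isClosed_closure.mem_of_tendsto hvx (.of_forall fun k => hv (φ k)), φ, hφ, hvx⟩

variable {α : Type*} [MeasurableSpace α] {𝕜 : Type*} [RCLike 𝕜] {μ : Measure α}
  {ρ : (α → ℝ≥0∞) → ℝ≥0∞}

instance (hρ : IsLatticeQuasiNorm μ ρ) : IsTopologicalAddGroup (space 𝕜 hρ) :=
  AddGroupFilterBasis.isTopologicalAddGroup _

theorem nhds_zero_space (hρ : IsLatticeQuasiNorm μ ρ) :
    𝓝 (0 : space 𝕜 hρ) = comap (fun f : space 𝕜 hρ => qnorm ρ (f : α →ₘ[μ] 𝕜)) (𝓝 0) :=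
  nhds_zero_quasiNormBasis (fun f : space 𝕜 hρ => qnorm ρ (f : α →ₘ[μ] 𝕜)) _ _ _

instance (hρ : IsLatticeQuasiNorm μ ρ) :
    TopologicalSpace.PseudoMetrizableSpace (space 𝕜 hρ) :=
  have : (𝓝 (0 : space 𝕜 hρ)).IsCountablyGenerated := by
    rw [nhds_zero_space]
    infer_instance
  pseudoMetrizableSpace_of_nhds_zero

theorem tendsto_space_iff (hρ : IsLatticeQuasiNorm μ ρ) {u : ℕ → space 𝕜 hρ} {g : space 𝕜 hρ} :
    Tendsto u atTop (𝓝 g) ↔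
      Tendsto (fun k => qnorm ρ ((u k : α →ₘ[μ] 𝕜) - (g : α →ₘ[μ] 𝕜))) atTop (𝓝 0) := by
  rw [← tendsto_sub_nhds_zero_iff, nhds_zero_space, tendsto_comap_iff]
  rfl

theorem nhds_zero_besov {n : ℕ} {L : (EuclideanSpace ℝ (Fin n) → ℝ≥0∞) → ℝ≥0∞}
    {Y : (ℝ → ℝ≥0∞) → ℝ≥0∞} (hL : IsLatticeQuasiNorm volume L)
    (hY : IsLatticeQuasiNorm (volume.restrict (Ioo (0 : ℝ) 1)) Y) :
    𝓝 (0 : besov 𝕜 hL hY) = comap (fun f : besov 𝕜 hL hY =>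
      besovNorm L Y (f : EuclideanSpace ℝ (Fin n) →ₘ[volume] 𝕜)) (𝓝 0) :=
  nhds_zero_quasiNormBasis (fun f : besov 𝕜 hL hY =>
    besovNorm L Y (f : EuclideanSpace ℝ (Fin n) →ₘ[volume] 𝕜)) _ _ _

end Topology

/-! ### Uniformly absolutely continuous quasi-norms -/

section UAC

variable {α : Type*} [MeasurableSpace α] {𝕜 : Type*} [RCLike 𝕜] {μ : Measure α}
  {ρ : (α → ℝ≥0∞) → ℝ≥0∞} {C : ℝ≥0}

/-- Fatou's lemma for `ρ`, from monotone convergence for the infima of the tails. -/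
theorem IsLatticeQuasiNormWith.le_of_tendsto (h : IsLatticeQuasiNormWith μ C ρ)
    {f : ℕ → α → ℝ≥0∞} {g : α → ℝ≥0∞} (hf : ∀ k, AEMeasurable (f k) μ) (hg : AEMeasurable g μ)
    (hfg : ∀ᵐ x ∂μ, Tendsto (fun k => f k x) atTop (𝓝 (g x))) {c : ℝ≥0∞}
    (hc : ∀ᶠ k in atTop, ρ (f k) ≤ c) : ρ g ≤ c := by
  let F (j : ℕ) (x : α) : ℝ≥0∞ := ⨅ i, f (i + j) x
  have hF (j : ℕ) : AEMeasurable (F j) μ := .iInf fun i => hf (i + j)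
  have hmono (x : α) : Monotone fun j => F j x := by
    refine monotone_nat_of_le_succ fun j => le_iInf fun i => ?_
    exact (iInf_le _ (i + 1)).trans_eq (by rw [add_assoc, add_comm 1 j])
  refine _root_.le_of_tendsto (h.tendsto_of_monotone F g hF hg (.of_forall hmono) ?_)
    (hc.mono fun j hj => (h.mono _ _ (hf j) (hF j) (.of_forall fun x => ?_)).trans hj)
  · filter_upwards [hfg] with x hx
    rw [← hx.liminf_eq, liminf_eq_iSup_iInf_of_nat']
    exact tendsto_atTop_iSup (hmono x)
  · exact (iInf_le _ 0).trans_eq (by rw [zero_add])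

theorem aemeasurable_indicator_enorm (f : α →ₘ[μ] 𝕜) {E : Set α} (hE : MeasurableSet E) :
    AEMeasurable (E.indicator fun x => ‖f x‖ₑ) μ :=
  (aemeasurable_enorm f).indicator hE

theorem IsLatticeQuasiNormWith.qnormOn_add_le (h : IsLatticeQuasiNormWith μ C ρ)
    (f g : α →ₘ[μ] 𝕜) {E : Set α} (hE : MeasurableSet E) :
    qnormOn ρ (f + g) E ≤ C * (qnormOn ρ f E + qnormOn ρ g E) := by
  have hf := aemeasurable_indicator_enorm f hE
  have hg := aemeasurable_indicator_enorm g hE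
  refine (h.mono _ _ (hf.add hg) (aemeasurable_indicator_enorm _ hE) ?_).trans
    (h.add_le _ _ hf hg)
  filter_upwards [AEEqFun.coeFn_add f g] with x hx
  by_cases hxE : x ∈ E
  · simpa [hxE, hx] using enorm_add_le (f x) (g x)
  · simp [hxE]

theorem IsLatticeQuasiNormWith.qnormOn_smul (h : IsLatticeQuasiNormWith μ C ρ)
    (c : 𝕜) (f : α →ₘ[μ] 𝕜) {E : Set α} (hE : MeasurableSet E) :
    qnormOn ρ (c • f) E = ‖c‖ₑ * qnormOn ρ f E := by
  have hf := aemeasurable_indicator_enorm f hE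
  refine (h.congr (aemeasurable_indicator_enorm _ hE) (hf.const_mul _) ?_).trans
    (h.const_mul ‖c‖₊ _ hf)
  filter_upwards [AEEqFun.coeFn_smul c f] with x hx
  by_cases hxE : x ∈ E
  · simp [hxE, hx, enorm_eq_nnnorm]
  · simp [hxE]

theorem IsLatticeQuasiNormWith.qnormOn_le_qnorm (h : IsLatticeQuasiNormWith μ C ρ)
    (f : α →ₘ[μ] 𝕜) {E : Set α} (hE : MeasurableSet E) : qnormOn ρ f E ≤ qnorm ρ f :=
  h.mono _ _ (aemeasurable_enorm f) (aemeasurable_indicator_enorm f hE)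
    (.of_forall fun _ => indicator_le_self _ _ _)

theorem IsLatticeQuasiNormWith.qnorm_sub_comm (h : IsLatticeQuasiNormWith μ C ρ)
    (f g : α →ₘ[μ] 𝕜) : qnorm ρ (f - g) = qnorm ρ (g - f) := by
  have h1 := h.qnorm_smul (-1 : 𝕜) (g - f)
  have e : (-1 : 𝕜) • (g - f) = f - g := (neg_one_smul 𝕜 (g - f)).trans (neg_sub g f)
  rwa [e, enorm_neg, enorm_one, one_mul] at h1

/-- A subset of `X_a` that is contained in a compact subset of `X` has uniformly absolutely
continuous quasi-norm. -/
theorem isUAC_of_forall_mem_isCompact (hρ : IsLatticeQuasiNorm μ ρ) {K : Set (space 𝕜 hρ)}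
    (hK : IsCompact K) {A : Set (α →ₘ[μ] 𝕜)} (hA : A ⊆ acPart 𝕜 hρ)
    (hAK : ∀ f (hf : f ∈ A), (⟨f, (hA hf).1⟩ : space 𝕜 hρ) ∈ K) : IsUAC hρ A := by
  obtain ⟨C, hC, h⟩ := id hρ
  refine ⟨hA, fun E hE ε hε => ?_⟩
  by_contra! hcon
  choose f hfA n hn hfn using hcon
  obtain ⟨z, -, φ, hφ, hz⟩ := hK.tendsto_subseq (x := fun k => ⟨f k, (hA (hfA k)).1⟩)
    (fun k => hAK _ (hfA k))
  replace hz := (tendsto_space_iff hρ).1 hz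
  -- Compare `f (φ k)` with the fixed member `f (φ i)`,
  -- as the limit `z` is not known to lie in `X_a`.
  have hbd (k i : ℕ) : ε ≤ C * (qnorm ρ (f (φ k) - (z : α →ₘ[μ] 𝕜)) +
      C * (qnorm ρ (f (φ i) - (z : α →ₘ[μ] 𝕜)) + qnormOn ρ (f (φ i)) (E (n (φ k))))) := by
    have hm := hE.1 (n (φ k))
    have e : f (φ k) = (f (φ k) - (z : α →ₘ[μ] 𝕜)) +
        (((z : α →ₘ[μ] 𝕜) - f (φ i)) + f (φ i)) := by abel
    calc ε ≤ qnormOn ρ (f (φ k)) (E (n (φ k))) := hfn _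
      _ = qnormOn ρ ((f (φ k) - (z : α →ₘ[μ] 𝕜)) +
            (((z : α →ₘ[μ] 𝕜) - f (φ i)) + f (φ i))) (E (n (φ k))) := by rw [← e]
      _ ≤ C * (qnormOn ρ (f (φ k) - (z : α →ₘ[μ] 𝕜)) (E (n (φ k))) +
            C * (qnormOn ρ ((z : α →ₘ[μ] 𝕜) - f (φ i)) (E (n (φ k)))
              + qnormOn ρ (f (φ i)) (E (n (φ k))))) := by
          refine (h.qnormOn_add_le _ _ hm).trans ?_
          gcongr
          exact h.qnormOn_add_le _ _ hm
      _ ≤ _ := by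
          rw [h.qnorm_sub_comm (f (φ i))]
          gcongr <;> exact h.qnormOn_le_qnorm _ hm
  have hnφ : Tendsto (fun k => n (φ k)) atTop atTop :=
    tendsto_atTop_mono (fun k => hn (φ k)) hφ.tendsto_atTop
  have hlim (i : ℕ) : ε ≤ C * (C * qnorm ρ (f (φ i) - (z : α →ₘ[μ] 𝕜))) := by
    have h1 := ((hA (hfA (φ i))).2 E hE).comp hnφ
    have h2 := ENNReal.Tendsto.const_mul (a := (C : ℝ≥0∞)) (hz.add
      (ENNReal.Tendsto.const_mul (a := (C : ℝ≥0∞))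
        (h1.const_add (qnorm ρ (f (φ i) - (z : α →ₘ[μ] 𝕜))))
        (.inr ENNReal.coe_ne_top))) (.inr ENNReal.coe_ne_top)
    rw [add_zero, zero_add] at h2
    exact ge_of_tendsto' h2 fun k => hbd k i
  have h3 := ENNReal.Tendsto.const_mul (a := (C : ℝ≥0∞)) (ENNReal.Tendsto.const_mul
    (a := (C : ℝ≥0∞)) hz (.inr ENNReal.coe_ne_top)) (.inr ENNReal.coe_ne_top)
  rw [mul_zero, mul_zero] at h3
  exact hε.not_ge (ge_of_tendsto' h3 hlim)

/-- Egorov's observation: for an almost everywhere convergent sequence, the sets where some two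
late terms differ by more than `δ` tend to the empty set. -/
theorem tendstoEmpty_of_tendsto {u : ℕ → α →ₘ[μ] 𝕜} {G : α → 𝕜}
    (h : ∀ᵐ x ∂μ, Tendsto (fun k => u k x) atTop (𝓝 (G x))) {δ : ℝ≥0} (hδ : 0 < δ) :
    TendstoEmpty μ fun m => ⋃ j ≥ m, ⋃ k ≥ m, {x | (δ : ℝ≥0∞) < ‖u j x - u k x‖ₑ} := by
  refine ⟨fun m => ?_, ?_⟩
  · refine .iUnion fun j => .iUnion fun _ => .iUnion fun k => .iUnion fun _ => ?_
    exact measurableSet_lt measurable_const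
      ((u j).stronglyMeasurable.sub (u k).stronglyMeasurable).enorm
  · refine measure_mono_null (fun x hx => ?_) (ae_iff.1 h)
    intro hconv
    obtain ⟨N, hN⟩ := EMetric.cauchySeq_iff.1 hconv.cauchySeq δ (by exact_mod_cast hδ)
    simp only [mem_iInter, mem_iUnion, mem_ofPred_eq] at hx
    obtain ⟨m, hm, j, hj, k, hk, hlt⟩ := hx N
    refine hlt.not_ge ?_
    rw [← edist_eq_enorm_sub]
    exact (hN j (hm.trans hj) k (hm.trans hk)).le

/-- A sequence with uniformly absolutely continuous quasi-norm that converges almost everywhere, on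
a space of finite measure, is a Cauchy sequence. -/
theorem IsUAC.exists_forall_qnorm_sub_le [IsFiniteMeasure μ] (hρ : IsFunctionQuasiNorm μ ρ)
    {K : Set (α →ₘ[μ] 𝕜)} (hK : IsUAC hρ.lattice K) {u : ℕ → α →ₘ[μ] 𝕜} (hu : ∀ k, u k ∈ K)
    {G : α → 𝕜} (hG : ∀ᵐ x ∂μ, Tendsto (fun k => u k x) atTop (𝓝 (G x)))
    {ε : ℝ≥0} (hε : 0 < ε) :
    ∃ N, ∀ j ≥ N, ∀ k ≥ N, qnorm ρ (u j - u k) ≤ ε := by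
  obtain ⟨C, hC, h⟩ := hρ.lattice
  obtain ⟨D, hD⟩ := WithTop.ne_top_iff_exists.1
    (hρ.indicator_lt_top univ .univ (measure_lt_top μ univ)).ne
  rw [indicator_univ] at hD
  change (D : ℝ≥0∞) = _ at hD
  have hC0 : 0 < C := one_pos.trans_le hC
  -- Chosen so that `C * (C * (η + η) + δ * D) ≤ ε / 2 + ε / 4`.
  set δ : ℝ≥0 := ε / (4 * C * (D + 1))
  set η : ℝ≥0 := ε / (4 * C ^ 2)
  have hη : 0 < η := by positivity
  have hδ : 0 < δ := by positivity
  have hE := tendstoEmpty_of_tendsto hG hδ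
  set E : ℕ → Set α := fun m => ⋃ j ≥ m, ⋃ k ≥ m, {x | (δ : ℝ≥0∞) < ‖u j x - u k x‖ₑ} with hEdef
  obtain ⟨N, hN⟩ := hK.2 E hE η (by exact_mod_cast hη)
  refine ⟨N, fun j hj k hk => ?_⟩
  have hindj := aemeasurable_indicator_enorm (u j) (hE.1 N)
  have hindk := aemeasurable_indicator_enorm (u k) (hE.1 N)
  have hle : (fun x => ‖(u j - u k) x‖ₑ) ≤ᵐ[μ] fun x =>
      ((E N).indicator (fun x => ‖u j x‖ₑ) x + (E N).indicator (fun x => ‖u k x‖ₑ) x)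
        + (δ : ℝ≥0∞) * 1 := by
    filter_upwards [AEEqFun.coeFn_sub (u j) (u k)] with x hx
    rw [hx, Pi.sub_apply]
    by_cases hxE : x ∈ E N
    · simp only [hxE, indicator_of_mem]
      exact enorm_sub_le.trans le_self_add
    · have : ¬ (δ : ℝ≥0∞) < ‖u j x - u k x‖ₑ := fun hlt =>
        hxE (by simp only [hEdef, mem_iUnion]; exact ⟨j, hj, k, hk, hlt⟩)
      simpa [hxE] using this
  have hconst : AEMeasurable (fun _ : α => (1 : ℝ≥0∞)) μ := aemeasurable_const
  calc qnorm ρ (u j - u k)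
      ≤ ρ fun x => ((E N).indicator (fun x => ‖u j x‖ₑ) x + (E N).indicator (fun x => ‖u k x‖ₑ) x)
        + (δ : ℝ≥0∞) * 1 :=
        h.mono _ _ ((hindj.add hindk).add (hconst.const_mul _)) (aemeasurable_enorm _) hle
    _ ≤ C * (C * (qnormOn ρ (u j) (E N) + qnormOn ρ (u k) (E N)) + δ * ρ fun _ => 1) := by
        refine (h.add_le _ _ (hindj.add hindk) (hconst.const_mul _)).trans ?_
        rw [h.const_mul δ _ hconst]
        gcongr
        exact h.add_le _ _ hindj hindk
    _ ≤ C * (C * (η + η) + δ * D) := by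
        rw [← hD]
        gcongr
        exacts [(hN _ (hu j) N le_rfl).le, (hN _ (hu k) N le_rfl).le]
    _ ≤ ε := by
        norm_cast
        rw [← NNReal.coe_le_coe]
        have hC0' : (0 : ℝ) < C := hC0
        have hε' : (0 : ℝ) < ε := hε
        have hD0 : (0 : ℝ) ≤ D := D.2
        simp only [δ, η]
        push_cast
        have e : (C : ℝ) * (C * (ε / (4 * C ^ 2) + ε / (4 * C ^ 2)) + ε / (4 * C * (D + 1)) * D)
            = ε * (1 / 2 + 1 / 4 * (D / (D + 1))) := by
          field_simp
          ring
        rw [e]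
        have : (D : ℝ) / (D + 1) ≤ 1 := by rw [div_le_one (by positivity)]; linarith
        nlinarith

theorem IsUAC.exists_tendsto_qnorm_sub [IsFiniteMeasure μ] (hρ : IsFunctionQuasiNorm μ ρ)
    {K : Set (α →ₘ[μ] 𝕜)} (hK : IsUAC hρ.lattice K) {u : ℕ → α →ₘ[μ] 𝕜} (hu : ∀ k, u k ∈ K)
    {G : α → 𝕜} (hG : ∀ᵐ x ∂μ, Tendsto (fun k => u k x) atTop (𝓝 (G x))) :
    ∃ g ∈ space 𝕜 hρ.lattice, Tendsto (fun k => qnorm ρ (u k - g)) atTop (𝓝 0) := by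
  obtain ⟨C, hC, h⟩ := id hρ.lattice
  let g : α →ₘ[μ] 𝕜 := AEEqFun.mk G
    (aestronglyMeasurable_of_tendsto_ae atTop (fun k => (u k).aestronglyMeasurable) hG)
  have hlim (j : ℕ) : ∀ᵐ x ∂μ,
      Tendsto (fun k => ‖(u j - u k) x‖ₑ) atTop (𝓝 ‖(u j - g) x‖ₑ) := by
    filter_upwards [hG, AEEqFun.coeFn_mk G _, AEEqFun.coeFn_sub (u j) g,
      ae_all_iff.2 fun k => AEEqFun.coeFn_sub (u j) (u k)] with x hx hgx h1 h2
    simp only [h1, h2, Pi.sub_apply]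
    rw [show g x = G x from hgx]
    exact (hx.const_sub _).enorm
  have hsub {ε : ℝ≥0} (hε : 0 < ε) : ∃ N, ∀ j ≥ N, qnorm ρ (u j - g) ≤ ε := by
    obtain ⟨N, hN⟩ := hK.exists_forall_qnorm_sub_le hρ hu hG hε
    exact ⟨N, fun j hj => h.le_of_tendsto (fun k => aemeasurable_enorm _) (aemeasurable_enorm _)
      (hlim j) ((eventually_ge_atTop N).mono fun k hk => hN j hj k hk)⟩
  refine ⟨g, ?_, ENNReal.tendsto_atTop_zero.2 fun ε hε => ?_⟩
  · obtain ⟨N, hN⟩ := hsub one_pos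
    have h1 : u N - g ∈ space 𝕜 hρ.lattice := (hN N le_rfl).trans_lt ENNReal.coe_lt_top
    have h2 := sub_mem (hK.1 (hu N)).1 h1
    rwa [sub_sub_cancel] at h2
  · obtain ⟨δ, hδ, hδε⟩ := ENNReal.lt_iff_exists_nnreal_btwn.1 hε
    obtain ⟨N, hN⟩ := hsub (show 0 < δ by exact_mod_cast hδ)
    exact ⟨N, fun k hk => (hN k hk).trans hδε.le⟩

end UAC


/-! ### Local integrability of powers and smallness of the modulus of continuity -/

section Power

/-- A power quasi-Banach function space embeds locally into `L^b` for some `b ∈ (0, 1]`: this is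
the local `L¹` bound in the Banach function space equivalent to `ρ(f ^ (1/b)) ^ b`, applied to `f ^ b`. -/
theorem IsPowerQBFS.exists_lintegral_rpow_le {α : Type*} [MeasurableSpace α] {μ : Measure α}
    {ρ : (α → ℝ≥0∞) → ℝ≥0∞} (h : IsPowerQBFS μ ρ) :
    ∃ b : ℝ, 0 < b ∧ b ≤ 1 ∧ ∀ E, MeasurableSet E → μ E < ∞ → ∃ c : ℝ≥0,
      ∀ f, AEMeasurable f μ → ∫⁻ x in E, f x ^ b ∂μ ≤ c * ρ f ^ b := by
  obtain ⟨b, hb, hb1, τ, hτ, d, -, hd⟩ := h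
  refine ⟨b, hb, hb1, fun E hE hμE => ?_⟩
  obtain ⟨c, -, hc⟩ := hτ.lintegral_le E hE hμE
  refine ⟨c * d, fun f hf => ?_⟩
  have hfb := hf.pow_const b
  have e : powerFunctional b ρ (fun x => f x ^ b) = ρ f ^ b := by
    simp only [powerFunctional, ← ENNReal.rpow_mul, mul_one_div_cancel hb.ne', ENNReal.rpow_one]
  calc ∫⁻ x in E, f x ^ b ∂μ ≤ c * τ fun x => f x ^ b := hc _ hfb
    _ ≤ c * (d * ρ f ^ b) := by
        rw [← e]
        gcongr
        exact (hd _ hfb).2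
    _ = _ := by rw [ENNReal.coe_mul, mul_assoc]

/-- If `‖1‖_Y = ∞`, the monotone functions in the unit ball of `Y` are uniformly small near `0`. -/
theorem exists_forall_monotone_le {Y : (ℝ → ℝ≥0∞) → ℝ≥0∞}
    (hY : IsLatticeQuasiNorm (volume.restrict (Ioo (0 : ℝ) 1)) Y) (hYone : Y (fun _ => 1) = ∞)
    {ε : ℝ≥0} (hε : 0 < ε) :
    ∃ t > 0, ∀ m : ℝ → ℝ≥0∞, Monotone m → Y m ≤ 1 → m t ≤ ε := by
  obtain ⟨C, -, h⟩ := hY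
  have hmeas (t : ℝ) : AEMeasurable ((Ici t).indicator fun _ => (1 : ℝ≥0∞))
      (volume.restrict (Ioo (0 : ℝ) 1)) := aemeasurable_const.indicator measurableSet_Ici
  -- Monotone convergence: the indicators of `[1 / (k + 1), ∞)` increase to `1` on `(0, 1)`.
  have hlim : Tendsto (fun k : ℕ => Y ((Ici (1 / ((k : ℝ) + 1))).indicator fun _ => 1)) atTop
      (𝓝 ∞) := by
    rw [← hYone]
    refine h.tendsto_of_monotone _ _ (fun k => hmeas _) aemeasurable_const
      (.of_forall fun x j k hjk => ?_) ?_
    · exact indicator_le_indicator_of_subset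
        (Ici_subset_Ici.2 (one_div_le_one_div_of_le (by positivity) (by gcongr)))
        (fun _ => zero_le) x
    · filter_upwards [ae_restrict_mem measurableSet_Ioo] with x hx
      refine tendsto_const_nhds.congr' ?_
      filter_upwards [(tendsto_one_div_add_atTop_nhds_zero_nat (𝕜 := ℝ)).eventually_lt_const hx.1]
        with k hk
      rw [indicator_of_mem (mem_Ici.2 hk.le)]
  obtain ⟨k, hk⟩ := (hlim.eventually_const_lt
    (show ((ε⁻¹ : ℝ≥0) : ℝ≥0∞) < ∞ from ENNReal.coe_lt_top)).exists
  refine ⟨1 / ((k : ℝ) + 1), by positivity, fun m hm hYm => ?_⟩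
  by_contra! hlt
  have h1 : (ε : ℝ≥0∞) * Y ((Ici (1 / ((k : ℝ) + 1))).indicator fun _ => 1) ≤ 1 := by
    rw [← h.const_mul ε _ (hmeas _)]
    refine (h.mono _ _ hm.measurable.aemeasurable ((hmeas _).const_mul _)
      (.of_forall fun x => ?_)).trans hYm
    by_cases hx : x ∈ Ici (1 / ((k : ℝ) + 1))
    · simpa only [indicator_of_mem hx, mul_one] using hlt.le.trans (hm hx)
    · simp only [indicator_of_notMem hx, mul_zero, zero_le]
  refine h1.not_gt ?_
  have h2 := ENNReal.mul_lt_mul_right (a := (ε : ℝ≥0∞)) (by exact_mod_cast hε.ne')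
    ENNReal.coe_ne_top hk
  rwa [← ENNReal.coe_mul, mul_inv_cancel₀ hε.ne', ENNReal.coe_one] at h2

end Power

/-! ### Truncation -/

section Truncation

variable {𝕜 : Type*} [RCLike 𝕜]

/-- The map `z ↦ z / (1 + |z|)`, a homeomorphism of the scalar field onto its open unit ball. -/
noncomputable def truncate (z : 𝕜) : 𝕜 := (1 + ‖z‖)⁻¹ • z

theorem continuous_truncate : Continuous (truncate : 𝕜 → 𝕜) :=
  ((continuous_const.add continuous_norm).inv₀ fun z =>
    (add_pos_of_pos_of_nonneg one_pos (norm_nonneg z)).ne').smul continuous_id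

theorem norm_truncate (z : 𝕜) : ‖truncate z‖ = ‖z‖ / (1 + ‖z‖) := by
  rw [truncate, norm_smul, norm_inv, Real.norm_of_nonneg (by positivity)]
  field_simp

theorem norm_truncate_le_one (z : 𝕜) : ‖truncate z‖ ≤ 1 := by
  rw [norm_truncate, div_le_one (by positivity)]
  linarith

/-- The inverse of the truncation is `w ↦ w / (1 - |w|)`. -/
theorem smul_truncate (z : 𝕜) : (1 - ‖truncate z‖)⁻¹ • truncate z = z := by
  have h : (0 : ℝ) < 1 + ‖z‖ := by positivity
  have e : (1 - ‖truncate z‖)⁻¹ = 1 + ‖z‖ := by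
    rw [norm_truncate]
    field_simp
    simp
  rw [e, truncate, smul_smul, mul_inv_cancel₀ h.ne', one_smul]

theorem norm_truncate_sub_le (z w : 𝕜) : ‖truncate z - truncate w‖ ≤ 2 * ‖z - w‖ := by
  have hz : (0 : ℝ) < 1 + ‖z‖ := by positivity
  have hw : (0 : ℝ) < 1 + ‖w‖ := by positivity
  have e : truncate z - truncate w
      = (1 + ‖z‖)⁻¹ • ((z - w) + (‖w‖ - ‖z‖) • truncate w) := by
    rw [smul_add, smul_smul, smul_sub, truncate, truncate, smul_smul, sub_add, ← sub_smul]
    congr 2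
    field_simp
    ring
  have h1 : ‖(‖w‖ - ‖z‖) • truncate w‖ ≤ ‖z - w‖ := by
    rw [norm_smul, Real.norm_eq_abs, abs_sub_comm]
    exact (mul_le_of_le_one_right (abs_nonneg _) (norm_truncate_le_one w)).trans
      (abs_norm_sub_norm_le z w)
  rw [e, norm_smul, norm_inv, Real.norm_of_nonneg hz.le]
  calc (1 + ‖z‖)⁻¹ * ‖(z - w) + (‖w‖ - ‖z‖) • truncate w‖
      ≤ 1 * (‖z - w‖ + ‖z - w‖) := by
        gcongr
        · exact inv_le_one_of_one_le₀ (by linarith [norm_nonneg z])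
        · exact (norm_add_le _ _).trans (by gcongr)
    _ = _ := by ring

/-- Control in `L^b` becomes control in `L¹` after truncation, because the truncation is both
Lipschitz and bounded. -/
theorem enorm_truncate_sub_le_rpow (z w : 𝕜) {b : ℝ} (hb : 0 < b) (hb1 : b ≤ 1) :
    ‖truncate z - truncate w‖ₑ ≤ 2 * ‖z - w‖ₑ ^ b := by
  have key : ‖truncate z - truncate w‖ ≤ 2 * ‖z - w‖ ^ b := by
    rcases le_total ‖z - w‖ 1 with h | h
    · refine (norm_truncate_sub_le z w).trans ?_
      gcongr
      simpa using Real.rpow_le_rpow_of_exponent_ge' (norm_nonneg (z - w)) h hb.le hb1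
    · calc ‖truncate z - truncate w‖ ≤ 1 + 1 :=
            (norm_sub_le _ _).trans (add_le_add (norm_truncate_le_one z) (norm_truncate_le_one w))
        _ = 2 * 1 := by norm_num
        _ ≤ _ := by gcongr; exact Real.one_le_rpow h hb.le
  rw [← ofReal_norm, ← ofReal_norm, ENNReal.ofReal_rpow_of_nonneg (norm_nonneg _) hb.le,
    ← ENNReal.ofReal_ofNat 2, ← ENNReal.ofReal_mul (by norm_num)]
  exact ENNReal.ofReal_le_ofReal key

/-- Convergence of the truncations implies convergence, unless `|u k| → ∞`. The bound on the limit
inferior puts `G` in the open unit ball, where the truncation can be inverted. -/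
theorem tendsto_of_tendsto_truncate {u : ℕ → 𝕜} {G : 𝕜}
    (h : Tendsto (fun k => truncate (u k)) atTop (𝓝 G)) {b : ℝ} (hb : 0 < b)
    (hu : liminf (fun k => ‖u k‖ₑ ^ b) atTop < ∞) :
    Tendsto u atTop (𝓝 ((1 - ‖G‖)⁻¹ • G)) := by
  obtain ⟨M, hM, -⟩ := ENNReal.lt_iff_exists_nnreal_btwn.1 hu
  have hfreq : ∃ᶠ k in atTop, ‖truncate (u k)‖ ≤ 1 - (1 + (M : ℝ) ^ (1 / b))⁻¹ := by
    refine (frequently_lt_of_liminf_lt (by isBoundedDefault) hM).mono fun k hk => ?_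
    have h1 : ‖u k‖ ≤ (M : ℝ) ^ (1 / b) := by
      have h2 : ‖u k‖₊ ^ b < M := by
        rw [enorm_eq_nnnorm, ← ENNReal.coe_rpow_of_nonneg _ hb.le] at hk
        exact_mod_cast hk
      have h3 : ‖u k‖₊ ≤ M ^ (1 / b) := by
        rw [one_div, NNReal.le_rpow_inv_iff hb]
        exact h2.le
      exact_mod_cast h3
    rw [norm_truncate]
    have e : ‖u k‖ / (1 + ‖u k‖) = 1 - (1 + ‖u k‖)⁻¹ := by
      field_simp
      simp
    rw [e]
    gcongr
  have hG : ‖G‖ < 1 :=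
    (le_of_tendsto_of_frequently h.norm hfreq).trans_lt (sub_lt_self _ (by positivity))
  have hc : Tendsto (fun k => (1 - ‖truncate (u k)‖)⁻¹ • truncate (u k)) atTop
      (𝓝 ((1 - ‖G‖)⁻¹ • G)) :=
    ((h.norm.const_sub 1).inv₀ (sub_pos.2 hG).ne').smul h
  simpa only [smul_truncate] using hc

end Truncation

/-! ### Bounded sequences in the Besov space -/

section BesovSequences

variable {𝕜 : Type*} [RCLike 𝕜] {n : ℕ} {L : (EuclideanSpace ℝ (Fin n) → ℝ≥0∞) → ℝ≥0∞}
  {Y : (ℝ → ℝ≥0∞) → ℝ≥0∞}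

/-- Sequences in the unit ball of `B(L, Y)` have subsequences that converge almost everywhere on a
given ball. -/
theorem exists_subseq_tendsto_ae_of_besovNorm_le (hL : IsPowerQBFS volume L)
    (hY : IsLatticeQuasiNorm (volume.restrict (Ioo (0 : ℝ) 1)) Y) (hYone : Y (fun _ => 1) = ∞)
    {f : ℕ → EuclideanSpace ℝ (Fin n) →ₘ[volume] 𝕜} (hf : ∀ k, besovNorm L Y (f k) ≤ 1)
    (R : ℝ) :
    ∃ φ : ℕ → ℕ, StrictMono φ ∧ ∃ G : EuclideanSpace ℝ (Fin n) → 𝕜,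
      ∀ᵐ x ∂volume.restrict (Metric.ball 0 R),
        Tendsto (fun k => f (φ k) x) atTop (𝓝 (G x)) := by
  obtain ⟨b, hb, hb1, hbL⟩ := hL.exists_lintegral_rpow_le
  obtain ⟨c, hc⟩ := hbL (Metric.ball 0 R) Metric.isOpen_ball.measurableSet measure_ball_lt_top
  obtain ⟨φ, hφ, G, hG⟩ := exists_subseq_tendsto_ae_of_bounded
    (μ := (volume : Measure (EuclideanSpace ℝ (Fin n)))) (g := fun k x => truncate (f k x))
    (fun k => continuous_truncate.comp_stronglyMeasurable (f k).stronglyMeasurable)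
    (fun k x => norm_truncate_le_one _) R (by
      intro ε hε
      -- Chosen so that `2 * c * η ^ b ≤ ε`.
      set η : ℝ≥0 := (ε / (2 * (c + 1))) ^ (1 / b)
      have hη : 0 < η := NNReal.rpow_pos (by positivity)
      obtain ⟨t, ht, hm⟩ := exists_forall_monotone_le hY hYone hη
      refine ⟨t, ht, fun k z hz => ?_⟩
      have hLz : L (fun x => ‖f k (x + z) - f k x‖ₑ) ≤ η :=
        (le_iSup₂ (f := fun h (_ : ‖h‖ ≤ t) => L fun x => ‖f k (x + h) - f k x‖ₑ) z hz).trans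
          (hm _ (modulus_mono (f k)) (le_add_self.trans (hf k)))
      have hηb : (η : ℝ≥0∞) ^ b = ((ε / (2 * (c + 1)) : ℝ≥0) : ℝ≥0∞) := by
        rw [← ENNReal.coe_rpow_of_nonneg _ hb.le, ← NNReal.rpow_mul, one_div_mul_cancel hb.ne',
          NNReal.rpow_one]
      calc ∫⁻ x in Metric.ball 0 R, ‖truncate (f k (x + z)) - truncate (f k x)‖ₑ
          ≤ ∫⁻ x in Metric.ball 0 R, 2 * ‖f k (x + z) - f k x‖ₑ ^ b :=
            lintegral_mono fun x => enorm_truncate_sub_le_rpow _ _ hb hb1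
        _ = 2 * ∫⁻ x in Metric.ball 0 R, ‖f k (x + z) - f k x‖ₑ ^ b :=
            lintegral_const_mul' _ _ (by simp)
        _ ≤ 2 * (c * (η : ℝ≥0∞) ^ b) := by
            gcongr
            exact (hc _ (aemeasurable_diff (f k) z)).trans (by gcongr)
        _ ≤ ε := by
            rw [hηb]
            norm_cast
            have h1 : c * (ε / (2 * (c + 1))) ≤ (c + 1) * (ε / (2 * (c + 1))) := by
              gcongr
              exact le_self_add
            calc 2 * (c * (ε / (2 * (c + 1)))) ≤ 2 * ((c + 1) * (ε / (2 * (c + 1)))) := by gcongr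
              _ = ε := by field_simp)
  refine ⟨φ, hφ, fun x => (1 - ‖G x‖)⁻¹ • G x, ?_⟩
  have hmeas (k : ℕ) : Measurable fun x => ‖f (φ k) x‖ₑ ^ b :=
    (f (φ k)).stronglyMeasurable.enorm.pow_const b
  -- By Fatou's lemma, the limit inferior of `|f (φ k)|` is finite almost everywhere.
  have hfin : ∫⁻ x in Metric.ball 0 R, liminf (fun k => ‖f (φ k) x‖ₑ ^ b) atTop ≤ c := by
    refine (lintegral_liminf_le hmeas).trans (liminf_le_of_frequently_le' ?_)
    refine Frequently.of_forall fun k => (hc _ (aemeasurable_enorm (f (φ k)))).trans ?_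
    have h1 : L (fun x => ‖f (φ k) x‖ₑ) ≤ 1 := le_self_add.trans (hf (φ k))
    exact mul_le_of_le_one_right zero_le (ENNReal.rpow_le_one h1 hb.le)
  filter_upwards [hG, ae_lt_top (.liminf hmeas) (hfin.trans_lt ENNReal.coe_lt_top).ne] with x h1 h2
  exact tendsto_of_tendsto_truncate h1 hb h2

theorem restr_coeFn (Ω : Set (EuclideanSpace ℝ (Fin n)))
    (f : EuclideanSpace ℝ (Fin n) →ₘ[volume] 𝕜) : restr Ω f =ᵐ[volume.restrict Ω] f :=
  AEEqFun.coeFn_mk _ _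

variable {Ω : Set (EuclideanSpace ℝ (Fin n))} {Z : (EuclideanSpace ℝ (Fin n) → ℝ≥0∞) → ℝ≥0∞}

theorem isCompactOperator_besovRestr_of_isUAC (hL : IsLatticeQuasiNorm volume L)
    (hLpower : IsPowerQBFS volume L)
    (hY : IsLatticeQuasiNorm (volume.restrict (Ioo (0 : ℝ) 1)) Y) (hYone : Y (fun _ => 1) = ∞)
    (hΩ : Bornology.IsBounded Ω) (hZ : IsFunctionQuasiNorm (volume.restrict Ω) Z)
    (hmap : ∀ f ∈ besov 𝕜 hL hY, restr Ω f ∈ space 𝕜 hZ.lattice)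
    (hK : IsUAC hZ.lattice (restr Ω '' {f | f ∈ besov 𝕜 hL hY ∧ besovNorm L Y f ≤ 1})) :
    IsCompactOperator (besovRestr hL hY hZ.lattice hmap) := by
  obtain ⟨R, hR⟩ := hΩ.subset_ball 0
  have : IsFiniteMeasure (volume.restrict Ω) :=
    isFiniteMeasure_restrict.2 ((measure_mono hR).trans_lt measure_ball_lt_top).ne
  set T := besovRestr hL hY hZ.lattice hmap
  set U : Set (besov 𝕜 hL hY) :=
    {f | besovNorm L Y (f : EuclideanSpace ℝ (Fin n) →ₘ[volume] 𝕜) < 1} with hU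
  refine ⟨closure (T '' U), isCompact_closure_of_forall_exists_subseq fun u hu => ?_, ?_⟩
  · choose f hfU hfu using hu
    obtain ⟨φ, hφ, G, hG⟩ := exists_subseq_tendsto_ae_of_besovNorm_le hLpower hY hYone
      (f := fun k => (f k : EuclideanSpace ℝ (Fin n) →ₘ[volume] 𝕜)) (fun k => (hfU k).le) R
    have hmem (k : ℕ) : restr Ω (f (φ k) : EuclideanSpace ℝ (Fin n) →ₘ[volume] 𝕜) ∈
        restr Ω '' {f | f ∈ besov 𝕜 hL hY ∧ besovNorm L Y f ≤ 1} :=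
      ⟨_, ⟨(f (φ k)).2, (hfU _).le⟩, rfl⟩
    have hae : ∀ᵐ x ∂volume.restrict Ω, Tendsto (fun k =>
        restr Ω (f (φ k) : EuclideanSpace ℝ (Fin n) →ₘ[volume] 𝕜) x) atTop (𝓝 (G x)) := by
      filter_upwards [ae_restrict_of_ae_restrict_of_subset hR hG, ae_all_iff.2 fun k =>
        restr_coeFn Ω (f (φ k) : EuclideanSpace ℝ (Fin n) →ₘ[volume] 𝕜)] with x hx hx'
      simpa only [hx'] using hx
    obtain ⟨g, hg, hlim⟩ := hK.exists_tendsto_qnorm_sub hZ hmem hae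
    refine ⟨φ, hφ, ⟨g, hg⟩, (tendsto_space_iff _).2 (hlim.congr fun k => ?_)⟩
    rw [Function.comp_apply, ← hfu]
    rfl
  · have hU0 : U ∈ 𝓝 (0 : besov 𝕜 hL hY) := by
      rw [nhds_zero_besov]
      exact preimage_mem_comap (Iio_mem_nhds one_pos)
    exact mem_of_superset hU0 fun f hf => subset_closure (mem_image_of_mem T hf)

theorem isUAC_of_isCompactOperator_besovRestr (hL : IsLatticeQuasiNorm volume L)
    (hY : IsLatticeQuasiNorm (volume.restrict (Ioo (0 : ℝ) 1)) Y)
    (hZ : IsLatticeQuasiNorm (volume.restrict Ω) Z)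
    (hmap : ∀ f ∈ besov 𝕜 hL hY, restr Ω f ∈ acPart 𝕜 hZ)
    (hT : IsCompactOperator (besovRestr hL hY hZ fun f hf => (hmap f hf).1)) :
    IsUAC hZ (restr Ω '' {f | f ∈ besov 𝕜 hL hY ∧ besovNorm L Y f ≤ 1}) := by
  obtain ⟨K, hK, hKT⟩ := hT
  rw [nhds_zero_besov, (ENNReal.nhds_zero_basis.comap _).mem_iff] at hKT
  obtain ⟨ε, hε, hεK⟩ := hKT
  obtain ⟨δ, hδ, hδε⟩ := ENNReal.lt_iff_exists_nnreal_btwn.1 hε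
  replace hδ : 0 < δ := by exact_mod_cast hδ
  set A := restr Ω '' {f : EuclideanSpace ℝ (Fin n) →ₘ[volume] 𝕜 |
    f ∈ besov 𝕜 hL hY ∧ besovNorm L Y f ≤ δ}
  have hA : A ⊆ acPart 𝕜 hZ := by
    rintro _ ⟨f, hf, rfl⟩
    exact hmap f hf.1
  -- The ball of radius `δ` is mapped into `K`; the unit ball is handled by homogeneity.
  have hUAC : IsUAC hZ A := by
    refine isUAC_of_forall_mem_isCompact hZ hK hA ?_
    rintro _ ⟨f, hf, rfl⟩
    exact hεK (a := ⟨f, hf.1⟩) (hf.2.trans_lt hδε)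
  refine ⟨?_, fun E hE η hη => ?_⟩
  · rintro _ ⟨f, hf, rfl⟩
    exact hmap f hf.1
  obtain ⟨C, -, h⟩ := id hZ
  have hδe : ‖((δ : ℝ) : 𝕜)‖ₑ = δ := by
    rw [← ofReal_norm, RCLike.norm_ofReal, NNReal.abs_eq, ENNReal.ofReal_coe_nnreal]
  have hδ0 : (δ : ℝ≥0∞) ≠ 0 := by exact_mod_cast hδ.ne'
  obtain ⟨N, hN⟩ := hUAC.2 E hE (δ * η) (ENNReal.mul_pos hδ0 hη.ne')
  refine ⟨N, ?_⟩
  rintro _ ⟨f, ⟨hf, hf1⟩, rfl⟩ m hm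
  have h1 := hN (restr Ω (((δ : ℝ) : 𝕜) • f)) ⟨_, ⟨Submodule.smul_mem _ _ hf, by
    refine (besovNorm_smul_le hL hY _ f).trans ?_
    rw [hδe]
    exact mul_le_of_le_one_right zero_le hf1⟩, rfl⟩ m hm
  rw [map_smul, h.qnormOn_smul _ _ (hE.1 m), hδe] at h1
  exact lt_of_mul_lt_mul_left' h1

end BesovSequences

end QBFS

theorem mainTheorem5 {𝕜 : Type*} [RCLike 𝕜] {n : ℕ}
    (L : (EuclideanSpace ℝ (Fin n) → ℝ≥0∞) → ℝ≥0∞)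
    (hL : QBFS.IsFunctionQuasiNorm volume L)
    (hLpower : QBFS.IsPowerQBFS volume L)
    (hLa : ¬ QBFS.CoincidesWithBFS volume L →
      QBFS.acPart 𝕜 hL.lattice = (QBFS.space 𝕜 hL.lattice : Set _))
    (Y : (ℝ → ℝ≥0∞) → ℝ≥0∞)
    (hY : QBFS.IsLatticeQuasiNorm (volume.restrict (Ioo (0 : ℝ) 1)) Y)
    (hYone : Y (fun _ => 1) = ∞)
    (Ω : Set (EuclideanSpace ℝ (Fin n)))
    (hΩmeas : NullMeasurableSet Ω volume) (hΩbdd : Bornology.IsBounded Ω)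
    (hΩpos : 0 < volume Ω)
    (Z : (EuclideanSpace ℝ (Fin n) → ℝ≥0∞) → ℝ≥0∞)
    (hZ : QBFS.IsFunctionQuasiNorm (volume.restrict Ω) Z)
    (hmap : ∀ f ∈ QBFS.besov 𝕜 hL.lattice hY, QBFS.restr Ω f ∈ QBFS.acPart 𝕜 hZ.lattice) :
    IsCompactOperator
        (QBFS.besovRestr hL.lattice hY hZ.lattice fun f hf => (hmap f hf).1) ↔
      QBFS.IsUAC hZ.lattice
        (QBFS.restr Ω '' {f | f ∈ QBFS.besov 𝕜 hL.lattice hY ∧ QBFS.besovNorm L Y f ≤ 1}) :=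
  ⟨QBFS.isUAC_of_isCompactOperator_besovRestr hL.lattice hY hZ.lattice hmap,
    QBFS.isCompactOperator_besovRestr_of_isUAC hL.lattice hLpower hY hYone hΩbdd hZ _⟩
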